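/- Let $K\ge 2$, let $\mathcal X$ be a feature space, and let $P$ be the joint distribution of $(x,y)\in\mathcal X\times\{1,\dots,K\}$ (with density $p(x,y)$, say), whose $x$-marginal is denoted $P_X$. For $c=1,\dots,K-1$ let $\overline P_c$ be the distribution of a feature together with a set $\overline Y$ of $c$ complementary labels, given by $$\overline p_c(x,\overline Y)=\frac{1}{\binom{K-1}{c}}\sum_{y\notin\overline Y}p(x,y),\qquad |\overline Y|=c .$$ Let $\mathcal G$ be a class of measurable real functions on $\mathcal X$ and $\mathcal G^K$ the class of functions $g:\mathcal X\to\mathbb R^K$ all of whose coordinates lie in $\mathcal G$ (suprema over these classes are assumed measurable, as usual). Let $\ell:\mathbb R^K\times\{1,\dots,K\}\to[0,\infty)$ be a loss such that $\ell(g(x),y)\le C_\ell$ for all $g\in\mathcal G^K$, $x\in\mathcal X$ and all $y$, and such that $\ell(\cdot,y)$ is $L_\ell$-Lipschitz for the Euclidean norm, for every $y$. Put $R(g)=\mathbb E_{(x,y)\sim P}\,\ell(g(x),y)$ and suppose that $g^*$ minimizes $R$ over $\mathcal G^K$. Let $\alpha_1,\dots,\alpha_{K-1}\ge 0$ with $\sum_{c}\alpha_c=1$,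 and for each $c$ let $(x_i^c,\overline Y_i^c)$, $i=1,\dots,n_c$, with $n_c\ge1$, be i.i.d. samples from $\overline P_c$. The empirical multi-complementary risk is $$\hat R_{\mathrm{MCL}}(g)=\sum_{c=1}^{K-1}\frac{\alpha_c}{n_c}\sum_{i=1}^{n_c}\Big(\sum_{y=1}^K\ell(g(x_i^c),y)-\frac{K-1}{c}\sum_{y\in\overline Y_i^c}\ell(g(x_i^c),y)\Big),$$ and $\hat g_{\mathrm{MCL}}$ denotes any minimizer of $\hat R_{\mathrm{MCL}}$ over $\mathcal G^K$. Let $$\mathfrak R_n(\mathcal G)=\mathbb E_{x_1,\dots,x_n\sim P_X}\,\mathbb E_\sigma\,\sup_{g\in\mathcal G}\frac1n\sum_{i=1}^n\sigma_i g(x_i)\in[0,\infty]$$ be the Rademacher complexity, where the $x_i$ are i.i.d. and $\sigma$ is uniform on $\{-1,1\}^n$. Then for every $\delta>0$ (only $\delta<1$ being of interest), with probability at least $1-\delta$, $$R(\hat g_{\mathrm{MCL}})-R(g^*)\le\sum_{c=1}^{K-1}2K\Big(\frac{K-1}{c}+1\Big)\alpha_c\Big(2KL_\ell\,\mathfrak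 R_{n_c}(\mathcal G)+C_\ell\sqrt{\frac{\ln(2K/\delta)}{2n_c}}\Big)$$ (with $0\cdot\infty=0$). On the same event, if $B\ge 0$ is such that $\mathfrak R_n(\mathcal G)\le B/\sqrt n$ for all $n\ge1$, then $$R(\hat g_{\mathrm{MCL}})-R(g^*)\le 2K^2\Big(2KL_\ell B+C_\ell\sqrt{\tfrac{1}{2}\ln(2K/\delta)}\Big)\sum_{c=1}^{K-1}\frac1{\sqrt{n_c}},$$ i.e. the parametric rate $\mathcal O\big(\sum_{c}1/\sqrt{n_c}\big)$ holds, with a constant depending only on $K$, $L_\ell$, $C_\ell$, $B$ and $\delta$. -/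

import Mathlib

open MeasureTheory ProbabilityTheory
open scoped NNReal ENNReal

namespace MCL

noncomputable section

/-- Sets of labels form a finite discrete space. -/
instance instMeasurableSpaceLabelSet (K : ℕ) : MeasurableSpace (Finset (Fin K)) := ⊤

variable {X : Type*} [MeasurableSpace X] {K : ℕ}

/-- The class `𝒢^K` of decision functions `X → ℝ^K` all of whose coordinates lie in `𝒢`. -/
def productClass (K : ℕ) (G : Set (X → ℝ)) : Set (X → EuclideanSpace ℝ (Fin K)) :=
  {g | ∀ k : Fin K, (fun x => g x k) ∈ G}

/-- The classification risk `R(g) = 𝔼_{(x,y) ∼ P} ℓ(g(x), y)`. -/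
def risk (P : Measure (X × Fin K)) (ℓ : EuclideanSpace ℝ (Fin K) → Fin K → ℝ)
    (g : X → EuclideanSpace ℝ (Fin K)) : ℝ :=
  ∫ z, ℓ (g z.1) z.2 ∂P

/-- The law of a sample with `c` complementary labels. For every measurable `A` and every set `Y` of
`c` labels, `A × {Y}` gets the mass `(1 / (K-1 choose c)) ∑_{y ∉ Y} P (A × {y})`; in terms of
densities, `p_c(x, Y) = (1 / (K-1 choose c)) ∑_{y ∉ Y} p(x, y)`. -/
def compMeasure (P : Measure (X × Fin K)) (c : ℕ) : Measure (X × Finset (Fin K)) :=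
  ∑ Y ∈ Finset.powersetCard c (Finset.univ : Finset (Fin K)),
    (((K - 1).choose c : ℕ) : ℝ≥0∞)⁻¹ •
      ∑ y ∈ Yᶜ, (P.restrict (Prod.snd ⁻¹' {y})).map (fun z => (z.1, Y))

/-- The multi-complementary loss of a prediction `u ∈ ℝ^K` for a set `Y` of `c` complementary
labels: `∑_y ℓ(u, y) - ((K-1)/c) ∑_{y ∈ Y} ℓ(u, y)`. -/
def compLoss (ℓ : EuclideanSpace ℝ (Fin K) → Fin K → ℝ) (c : ℕ)
    (u : EuclideanSpace ℝ (Fin K)) (Y : Finset (Fin K)) : ℝ :=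
  ∑ y, ℓ u y - ((K : ℝ) - 1) / c * ∑ y ∈ Y, ℓ u y

/-- The empirical multi-complementary risk of `g` on the samples `s c i`, `1 ≤ c ≤ K - 1`,
`i < n c`, with weights `α`. -/
def empiricalRisk (ℓ : EuclideanSpace ℝ (Fin K) → Fin K → ℝ) (α : ℕ → ℝ) (n : ℕ → ℕ)
    (s : (c : ℕ) → Fin (n c) → X × Finset (Fin K)) (g : X → EuclideanSpace ℝ (Fin K)) : ℝ :=
  ∑ c ∈ Finset.Icc 1 (K - 1), α c / n c * ∑ i, compLoss ℓ c (g (s c i).1) (s c i).2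

/-- `ĝ` is a minimizer of the functional `F` over the class `H`. -/
def IsMinimizer {D : Type*} (F : D → ℝ) (H : Set D) (g : D) : Prop :=
  g ∈ H ∧ IsMinOn F H g

/-- The empirical Rademacher complexity `𝔼_σ sup_{g ∈ 𝒢} (1/n) ∑_i σ_i g(x_i)` at `x_1, …, x_n`, with
`σ` uniform on `{±1}^n`. The supremum is taken in the extended reals, so that nothing is lost if
it is infinite; the average over `σ` is nonnegative when `𝒢` is nonempty. -/
def empiricalRademacher (G : Set (X → ℝ)) {n : ℕ} (x : Fin n → X) : ℝ≥0∞ :=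
  (∑ σ : Fin n → ℤˣ, ⨆ g ∈ G, (((n : ℝ)⁻¹ * ∑ i, ((σ i : ℤ) : ℝ) * g (x i) : ℝ) : EReal)).toENNReal
    / 2 ^ n

/-- The Rademacher complexity `ℜ_n(𝒢)` for samples of size `n` drawn i.i.d. from `μ`. -/
def rademacher (μ : Measure X) (G : Set (X → ℝ)) (n : ℕ) : ℝ≥0∞ :=
  ∫⁻ x, empiricalRademacher G x ∂(Measure.pi fun _ : Fin n => μ)

/-- Measurability of suprema over a (possibly uncountable) function class `F`: for every sample size
and all weights, `(z_1, …, z_n) ↦ sup_{f ∈ F} ∑_i w_i f(z_i)` is measurable up to a null set of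
the i.i.d. sample. This holds for instance if `F` is a countable class of measurable functions. -/
def HasMeasurableSuprema {Z : Type*} [MeasurableSpace Z] (Q : Measure Z) (F : Set (Z → ℝ)) : Prop :=
  ∀ (n : ℕ) (w : Fin n → ℝ),
    AEMeasurable (fun z : Fin n → Z => ⨆ f ∈ F, ((∑ i, w i * f (z i) : ℝ) : EReal))
      (Measure.pi fun _ : Fin n => Q)

/-- The functions `(x, Y) ↦ R(g) - (multi-complementary loss of g(x) at Y)`, for `g ∈ 𝒢^K`. -/
def deviationClass (P : Measure (X × Fin K)) (ℓ : EuclideanSpace ℝ (Fin K) → Fin K → ℝ)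
    (G : Set (X → ℝ)) (c : ℕ) : Set (X × Finset (Fin K) → ℝ) :=
  (fun g => fun z => risk P ℓ g - compLoss ℓ c (g z.1) z.2) '' productClass K G

end

end MCL

namespace MCL

/-! The multi-complementary loss is an unbiased estimate of the risk: given the true label, the
complementary set is uniform among the `c`-sets avoiding it, and the factor `(K-1)/c` undoes the
probability `c/(K-1)` that such a set contains a given wrong label (`integral_compLoss`). Hence the
excess risk of an empirical minimizer is at most, for each `c` with weight `α c`, the sum of the
suprema of the centred empirical process and of its negative (`risk_sub_risk_le`).

Each supremum concentrates around its mean by McDiarmid's inequality, since replacing one sample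
point moves it by at most `W C / n`, with `W = K ((K-1)/c + 1)`. A union bound over `2 (K-1)` events
of probability at most `δ / (2K)` gives the deviation term.

The mean is bounded by symmetrization with an independent copy, then by vector contraction, which
passes from losses to the coordinates of the decision functions and so to `K` times the Rademacher
complexity of `G`. Contraction rests on Khintchine's inequality. Its constant `9/5` times the
Lipschitz factor `2K - 1 - 2c` of the loss stays below `W` (`weight_mul_le`), so the sharp
Khintchine constant is not needed.

Complexities may be infinite and suprema need not be attained. The bounds on the means are therefore
stated in `ℝ≥0∞`, and contraction is applied to a finite family of near-maximizers, one per sign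
pattern. -/

/-! ### Moments of sign sums and Khintchine's inequality -/

lemma sum_fin_cons {α M : Type*} [Fintype α] [AddCommMonoid M] {n : ℕ} (F : (Fin (n + 1) → α) → M) :
    ∑ e, F e = ∑ a, ∑ e : Fin n → α, F (Fin.cons a e) := by
  rw [← Fintype.sum_prod_type']
  exact (Fintype.sum_equiv (Fin.consEquiv fun _ => α) _ _ fun _ => rfl).symm

lemma sum_intUnits {M : Type*} [AddCommMonoid M] (F : ℤˣ → M) : ∑ u, F u = F 1 + F (-1) := by
  rw [show (Finset.univ : Finset ℤˣ) = {1, -1} from rfl, Finset.sum_pair (by decide)]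

lemma sum_signs_sq : ∀ {K : ℕ} (a : Fin K → ℝ),
    ∑ e : Fin K → ℤˣ, (∑ k, ((e k : ℤ) : ℝ) * a k) ^ 2 = 2 ^ K * ∑ k, a k ^ 2
  | 0, a => by simp
  | K + 1, a => by
    rw [sum_fin_cons, sum_intUnits, ← Finset.sum_add_distrib]
    have := sum_signs_sq (fun k => a (Fin.succ k))
    simp only [Fin.sum_univ_succ, Fin.cons_zero, Fin.cons_succ]
    rw [pow_succ, mul_add, mul_right_comm _ 2 (∑ _, _), ← this, Finset.sum_mul]
    have h : (2 : ℝ) ^ K * 2 * a 0 ^ 2 = ∑ e : Fin K → ℤˣ, 2 * a 0 ^ 2 := by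
      simp; ring
    rw [h, ← Finset.sum_add_distrib]
    refine Finset.sum_congr rfl fun e _ => ?_
    push_cast
    ring

/-- Odd powers of the first sign cancel, so the induction adds `6 a₀² T + a₀⁴` per pattern on
average, within the `6 a₀² T + 3 a₀⁴` gained by `3 (a₀² + T)²`. -/
lemma sum_signs_pow_four_le : ∀ {K : ℕ} (a : Fin K → ℝ),
    ∑ e : Fin K → ℤˣ, (∑ k, ((e k : ℤ) : ℝ) * a k) ^ 4 ≤ 2 ^ K * (3 * (∑ k, a k ^ 2) ^ 2)
  | 0, a => by simp
  | K + 1, a => by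
    rw [sum_fin_cons, sum_intUnits, ← Finset.sum_add_distrib]
    have h4 := sum_signs_pow_four_le (fun k => a (Fin.succ k))
    have h2 := sum_signs_sq (fun k => a (Fin.succ k))
    simp only [Fin.sum_univ_succ, Fin.cons_zero, Fin.cons_succ]
    set T := ∑ k : Fin K, a k.succ ^ 2
    have h : ∑ e : Fin K → ℤˣ,
        ((((1 : ℤˣ) : ℤ) : ℝ) * a 0 + ∑ k, ((e k : ℤ) : ℝ) * a k.succ) ^ 4
        + ∑ e : Fin K → ℤˣ,
        ((((-1 : ℤˣ) : ℤ) : ℝ) * a 0 + ∑ k, ((e k : ℤ) : ℝ) * a k.succ) ^ 4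
        = 2 * ∑ e : Fin K → ℤˣ, (∑ k, ((e k : ℤ) : ℝ) * a k.succ) ^ 4
          + 12 * a 0 ^ 2 * ∑ e : Fin K → ℤˣ, (∑ k, ((e k : ℤ) : ℝ) * a k.succ) ^ 2
          + 2 * a 0 ^ 4 * 2 ^ K := by
      have h0 : 2 * a 0 ^ 4 * 2 ^ K = ∑ e : Fin K → ℤˣ, 2 * a 0 ^ 4 := by simp; ring
      rw [h0, Finset.mul_sum, Finset.mul_sum, ← Finset.sum_add_distrib, ← Finset.sum_add_distrib,
        ← Finset.sum_add_distrib]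
      refine Finset.sum_congr rfl fun e _ => ?_
      push_cast
      ring
    rw [Finset.sum_add_distrib, h, h2]
    have : 0 ≤ (2 : ℝ) ^ K * a 0 ^ 4 := by positivity
    rw [pow_succ (2 : ℝ) K]
    nlinarith

/-- Khintchine's inequality for the first moment, with the constant `9 / 5`. -/
lemma norm_le_sum_abs_signs {K : ℕ} (a : EuclideanSpace ℝ (Fin K)) :
    2 ^ K * ‖a‖ ≤ 9 / 5 * ∑ e : Fin K → ℤˣ, |∑ k, ((e k : ℤ) : ℝ) * a k| := by
  rcases (norm_nonneg a).eq_or_lt with h0 | hr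
  · rw [← h0, mul_zero]
    positivity
  have hsq : ∑ k, a k ^ 2 = ‖a‖ ^ 2 := by
    rw [EuclideanSpace.norm_sq_eq]; simp
  set r := ‖a‖
  -- The two sides touch at `|s| = 3r/2`, a rational value near the optimal `√3 r`. Averaging with
  -- fourth moment at most `3 r⁴` leaves the factor `1 - 3 · 4/27 = 5/9`.
  have key : ∀ s : ℝ, s ^ 2 / r - 4 / 27 * s ^ 4 / r ^ 3 ≤ |s| := by
    intro s
    rw [← sq_abs s, show s ^ 4 = |s| ^ 4 by rw [← abs_pow, abs_of_nonneg (by positivity)]]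
    have hs := abs_nonneg s
    generalize |s| = t at hs
    have : t - (t ^ 2 / r - 4 / 27 * t ^ 4 / r ^ 3)
        = t * ((2 * t - 3 * r) ^ 2 * (t + 3 * r)) / (27 * r ^ 3) := by
      field_simp
      ring
    have h2 : 0 ≤ t * ((2 * t - 3 * r) ^ 2 * (t + 3 * r)) / (27 * r ^ 3) := by positivity
    linarith
  have hsum := Finset.sum_le_sum fun (e : Fin K → ℤˣ) (_ : e ∈ Finset.univ) =>
    key (∑ k, ((e k : ℤ) : ℝ) * a k)
  have h2 := sum_signs_sq a
  have h4 := sum_signs_pow_four_le a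
  rw [Finset.sum_sub_distrib, ← Finset.sum_div, ← Finset.sum_div, ← Finset.mul_sum, h2, hsq] at hsum
  rw [hsq] at h4
  have h5 : 4 / 27 * (∑ e : Fin K → ℤˣ, (∑ k, ((e k : ℤ) : ℝ) * a k) ^ 4) / r ^ 3
      ≤ 4 / 27 * (2 ^ K * (3 * (r ^ 2) ^ 2)) / r ^ 3 := by gcongr
  have h6 : 4 / 27 * (2 ^ K * (3 * (r ^ 2) ^ 2)) / r ^ 3 = 4 / 9 * (2 ^ K * r) := by
    field_simp; ring
  have h7 : 2 ^ K * r ^ 2 / r = 2 ^ K * r := by field_simp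
  linarith

/-! ### Vector contraction over a finite index set -/

section Contraction

variable {ι : Type*} [Finite ι]

lemma le_ciSup_of_finite (f : ι → ℝ) (i : ι) : f i ≤ ⨆ j, f j :=
  le_ciSup (Set.finite_range f).bddAbove i

variable [Nonempty ι] {K : ℕ}

/-- For maximizers `f`, `g` of the two suprema, `ψ f - ψ g` is at most `Λ ‖v f - v g‖`, which
Khintchine's inequality replaces by an average of absolute values of linear forms. The symmetry `e ↦
-e` then identifies the sums of the two resulting suprema. -/
lemma contraction_step (A ψ : ι → ℝ) (v : ι → EuclideanSpace ℝ (Fin K)) {Λ : ℝ} (hΛ : 0 ≤ Λ)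
    (h : ∀ i j, |ψ i - ψ j| ≤ Λ * ‖v i - v j‖) :
    2 ^ K * ((⨆ i, (A i + ψ i)) + ⨆ i, (A i - ψ i)) ≤
      2 * ∑ e : Fin K → ℤˣ, ⨆ i, (A i + 9 / 5 * Λ * ∑ k, ((e k : ℤ) : ℝ) * v i k) := by
  obtain ⟨f, hf⟩ := exists_eq_ciSup_of_finite (f := fun i => A i + ψ i)
  obtain ⟨g, hg⟩ := exists_eq_ciSup_of_finite (f := fun i => A i - ψ i)
  rw [← hf, ← hg]
  have hneg : ∑ e : Fin K → ℤˣ, ⨆ i, (A i + 9 / 5 * Λ * ∑ k, ((e k : ℤ) : ℝ) * v i k)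
      = ∑ e : Fin K → ℤˣ, ⨆ i, (A i - 9 / 5 * Λ * ∑ k, ((e k : ℤ) : ℝ) * v i k) := by
    refine Fintype.sum_equiv (Equiv.neg _) _ _ fun e => ?_
    simp [sub_eq_add_neg]
  -- The absolute value is realized by testing the two suprema at `f` and `g`, or at `g` and `f`,
  -- whichever order gives the right sign.
  have hpt : ∀ e : Fin K → ℤˣ,
      A f + A g + 9 / 5 * Λ * |∑ k, ((e k : ℤ) : ℝ) * (v f - v g) k| ≤
      (⨆ i, (A i + 9 / 5 * Λ * ∑ k, ((e k : ℤ) : ℝ) * v i k))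
        + ⨆ i, (A i - 9 / 5 * Λ * ∑ k, ((e k : ℤ) : ℝ) * v i k) := by
    intro e
    have e1 := le_ciSup_of_finite (fun i => A i + 9 / 5 * Λ * ∑ k, ((e k : ℤ) : ℝ) * v i k)
    have e2 := le_ciSup_of_finite (fun i => A i - 9 / 5 * Λ * ∑ k, ((e k : ℤ) : ℝ) * v i k)
    have h1 := e1 f
    have h2 := e1 g
    have h3 := e2 f
    have h4 := e2 g
    simp only [PiLp.sub_apply, mul_sub, Finset.sum_sub_distrib]
    rcases abs_cases (∑ k, ((e k : ℤ) : ℝ) * v f k - ∑ k, ((e k : ℤ) : ℝ) * v g k) with h | h <;>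
    rw [h.1] <;> linarith
  have hsum := Finset.sum_le_sum fun e (_ : e ∈ Finset.univ) => hpt e
  rw [Finset.sum_add_distrib, Finset.sum_add_distrib (g := fun e => ⨆ i, (A i - _)), ← hneg,
    ← Finset.mul_sum] at hsum
  have hk := mul_le_mul_of_nonneg_left (norm_le_sum_abs_signs (v f - v g)) hΛ
  have hl := mul_le_mul_of_nonneg_left ((le_abs_self _).trans (h f g)) (pow_nonneg (zero_le_two (α := ℝ)) K)
  simp at hsum hk
  linarith

/-- The vector contraction inequality for Rademacher averages over a finite class. -/
lemma vector_contraction {Λ : ℝ} (hΛ : 0 ≤ Λ) : ∀ {n : ℕ} (A : ι → ℝ) (ψ : Fin n → ι → ℝ)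
    (v : Fin n → ι → EuclideanSpace ℝ (Fin K))
    (_ : ∀ m i j, |ψ m i - ψ m j| ≤ Λ * ‖v m i - v m j‖),
    (2 ^ K) ^ n * ∑ ε : Fin n → ℤˣ, ⨆ i, (A i + ∑ m, ((ε m : ℤ) : ℝ) * ψ m i) ≤
      2 ^ n * ∑ e : Fin n → Fin K → ℤˣ,
        ⨆ i, (A i + 9 / 5 * Λ * ∑ m, ∑ k, ((e m k : ℤ) : ℝ) * v m i k)
  | 0, A, ψ, v, h => by simp
  | n + 1, A, ψ, v, h => by
    rw [sum_fin_cons, sum_fin_cons, sum_intUnits, ← Finset.sum_add_distrib]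
    simp only [Fin.sum_univ_succ, Fin.cons_zero, Fin.cons_succ]
    have step : ∀ ε : Fin n → ℤˣ,
        2 ^ K * ((⨆ i, (A i + ((((1 : ℤˣ) : ℤ) : ℝ) * ψ 0 i + ∑ m, ((ε m : ℤ) : ℝ) * ψ m.succ i)))
          + ⨆ i, (A i + ((((-1 : ℤˣ) : ℤ) : ℝ) * ψ 0 i + ∑ m, ((ε m : ℤ) : ℝ) * ψ m.succ i)))
        ≤ 2 * ∑ e : Fin K → ℤˣ, ⨆ i, ((A i + 9 / 5 * Λ * ∑ k, ((e k : ℤ) : ℝ) * v 0 i k)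
            + ∑ m, ((ε m : ℤ) : ℝ) * ψ m.succ i) := by
      intro ε
      have := contraction_step (fun i => A i + ∑ m, ((ε m : ℤ) : ℝ) * ψ m.succ i) (ψ 0) (v 0) hΛ (h 0)
      have e1 (a b c : ℝ) : a + ((((1 : ℤˣ) : ℤ) : ℝ) * b + c) = a + c + b := by push_cast; ring
      have e2 (a b c : ℝ) : a + ((((-1 : ℤˣ) : ℤ) : ℝ) * b + c) = a + c - b := by push_cast; ring
      simpa only [e1, e2, add_right_comm] using this
    -- The offset `A` is arbitrary precisely so that it can absorb the coordinate already
    -- linearized.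
    have ih := fun e : Fin K → ℤˣ => vector_contraction hΛ
      (fun i => A i + 9 / 5 * Λ * ∑ k, ((e k : ℤ) : ℝ) * v 0 i k)
      (fun m => ψ m.succ) (fun m => v m.succ) (fun m => h m.succ)
    have s1 := Finset.sum_le_sum fun ε (_ : ε ∈ Finset.univ) => step ε
    have s2 := Finset.sum_le_sum fun e (_ : e ∈ Finset.univ) => ih e
    rw [← Finset.mul_sum, ← Finset.mul_sum, Finset.sum_comm] at s1
    rw [← Finset.mul_sum, ← Finset.mul_sum] at s2
    have s3 := mul_le_mul_of_nonneg_left s1 (show (0 : ℝ) ≤ (2 ^ K) ^ n by positivity)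
    rw [pow_succ, mul_assoc, pow_succ]
    refine s3.trans ?_
    rw [mul_left_comm, mul_comm (2 ^ n) (2 : ℝ), mul_assoc]
    refine mul_le_mul_of_nonneg_left (s2.trans_eq ?_) zero_le_two
    simp only [mul_add, add_assoc]

end Contraction

/-! ### McDiarmid's inequality -/

section BoundedDifferences

variable {Z : Type*} [MeasurableSpace Z] (Q : Measure Z) [IsProbabilityMeasure Q]

lemma measurePreserving_finCons (n : ℕ) :
    MeasurePreserving (fun p : (Fin n → Z) × Z => (Fin.cons p.2 p.1 : Fin (n + 1) → Z))
      ((Measure.pi fun _ : Fin n => Q).prod Q) (Measure.pi fun _ : Fin (n + 1) => Q) := by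
  have h1 := (measurePreserving_piFinSuccAbove (fun _ : Fin (n + 1) => Q) 0).symm
  have h2 := h1.comp (Measure.measurePreserving_swap (μ := Measure.pi fun _ : Fin n => Q) (ν := Q))
  convert h2 using 1
  ext p : 1
  exact (Fin.insertNth_zero' _ _).symm

variable {Q}

/-- Almost surely `X` lies in an interval of length `c` starting at its infimum over `s`, so
Hoeffding's lemma applies. -/
lemma mgf_le_of_ae_dist_le {X : Z → ℝ} {M c : ℝ} (hX : Measurable X) (hM : ∀ z, |X z| ≤ M)
    {s : Set Z} (hs : s ∈ ae Q) (hc : ∀ z ∈ s, ∀ z' ∈ s, |X z - X z'| ≤ c) (t : ℝ) :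
    ∫ z, Real.exp (t * (X z - ∫ z, X z ∂Q)) ∂Q ≤ Real.exp ((c / 2) ^ 2 * t ^ 2 / 2) := by
  have hne : s.Nonempty := Filter.nonempty_of_mem hs
  have hbdd : BddBelow (X '' s) := ⟨-M, by rintro _ ⟨z, -, rfl⟩; exact (abs_le.1 (hM z)).1⟩
  have h := hasSubgaussianMGF_of_mem_Icc (μ := Q) (a := sInf (X '' s)) (b := sInf (X '' s) + c)
    hX.aemeasurable (by
      filter_upwards [hs] with z hz
      refine ⟨csInf_le hbdd ⟨z, hz, rfl⟩, ?_⟩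
      have : X z - c ≤ sInf (X '' s) := by
        refine le_csInf (hne.image _) ?_
        rintro _ ⟨z', hz', rfl⟩
        linarith [(abs_le.1 (hc z hz z' hz')).2]
      linarith)
  have h2 := h.mgf_le t
  simpa [mgf, div_pow] using h2

/-- McDiarmid's bound for the moment generating function, for functions which have bounded
differences on a conull set. -/
lemma integral_exp_le_of_bounded_differences {c M : ℝ} : ∀ {n : ℕ} {f : (Fin n → Z) → ℝ}
    (_ : Measurable f) (_ : ∀ z, |f z| ≤ M) {s : Set (Fin n → Z)}
    (_ : s ∈ ae (Measure.pi fun _ : Fin n => Q))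
    (_ : ∀ z ∈ s, ∀ z' ∈ s, ∀ i, (∀ j, j ≠ i → z j = z' j) → |f z - f z'| ≤ c) (t : ℝ),
    ∫ z, Real.exp (t * (f z - ∫ z, f z ∂(Measure.pi fun _ : Fin n => Q)))
      ∂(Measure.pi fun _ : Fin n => Q) ≤ Real.exp (n * (c / 2) ^ 2 * t ^ 2 / 2)
  | 0, f, hf, hM, s, hs, hc, t => by
    have : f = fun _ => f default := by ext z; congr 1; exact Subsingleton.elim _ _
    rw [this]
    simp
  | n + 1, f, hf, hM, s, hs, hc, t => by
    have hφ := measurePreserving_finCons Q n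
    set ν := Measure.pi fun _ : Fin n => Q
    set π := Measure.pi fun _ : Fin (n + 1) => Q
    -- Averaging out the first coordinate preserves bounded differences in the others; for fixed
    -- `r`, Hoeffding's lemma controls the fluctuation around `h r`. The two variance proxies add
    -- up.
    let h : (Fin n → Z) → ℝ := fun r => ∫ z, f (Fin.cons z r) ∂Q
    have hfφ : Measurable fun p : (Fin n → Z) × Z => f (Fin.cons p.2 p.1) := hf.comp hφ.measurable
    have hh : Measurable h := hfφ.stronglyMeasurable.integral_prod_right'.measurable
    have hhM : ∀ r, |h r| ≤ M := fun r => by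
      simpa using norm_integral_le_of_norm_le_const (μ := Q) (C := M)
        (f := fun z => f (Fin.cons z r)) (.of_forall fun z => hM (Fin.cons z r))
    have hfr : ∀ r, Measurable fun z => f (Fin.cons z r) := fun r => hfφ.comp measurable_prodMk_left
    have hint : ∀ r, Integrable (fun z => f (Fin.cons z r)) Q := fun r =>
      .of_bound (hfr r).aestronglyMeasurable M (.of_forall fun z => hM _)
    let s' : Set (Fin n → Z) := {r | ∀ᵐ z ∂Q, (Fin.cons z r : Fin (n + 1) → Z) ∈ s}
    have hs' : s' ∈ ae ν := Measure.ae_ae_of_ae_prod (hφ.quasiMeasurePreserving.ae hs)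
    have hc' : ∀ r ∈ s', ∀ r' ∈ s', ∀ i, (∀ j, j ≠ i → r j = r' j) → |h r - h r'| ≤ c := by
      intro r hr r' hr' i hi
      simp only [h]
      rw [← integral_sub (hint r) (hint r')]
      have := norm_integral_le_of_norm_le_const (μ := Q) (C := c)
        (f := fun z => f (Fin.cons z r) - f (Fin.cons z r')) (by
        filter_upwards [hr, hr'] with z hz hz'
        refine hc _ hz _ hz' i.succ fun j hj => ?_
        induction j using Fin.cases with
        | zero => simp
        | succ j => simpa using hi j (by rintro rfl; exact hj rfl))
      simpa using this
    have ih := integral_exp_le_of_bounded_differences hh hhM hs' hc' t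
    have hprod : ∫ z, f z ∂π = ∫ r, h r ∂ν := by
      rw [← hφ.map_eq, integral_map hφ.aemeasurable hf.aestronglyMeasurable, integral_prod]
      exact .of_bound hfφ.aestronglyMeasurable M (.of_forall fun z => hM _)
    rw [hprod]
    set m := ∫ r, h r ∂ν
    have hexp : Measurable fun z => Real.exp (t * (f z - m)) := by fun_prop
    have hbd : ∀ x : ℝ, |x| ≤ M → ‖Real.exp (t * (x - m))‖ ≤ Real.exp (|t| * (M + |m|)) := by
      intro x hx
      rw [Real.norm_eq_abs, Real.abs_exp, Real.exp_le_exp]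
      refine (le_abs_self _).trans ?_
      rw [abs_mul]
      gcongr
      exact (abs_sub _ _).trans (by gcongr)
    rw [← hφ.map_eq, integral_map hφ.aemeasurable hexp.aestronglyMeasurable,
      integral_prod (fun p : (Fin n → Z) × Z => Real.exp (t * (f (Fin.cons p.2 p.1) - m))) (.of_bound (hexp.comp hφ.measurable).aestronglyMeasurable _ (.of_forall fun z => hbd _ (hM _)))]
    set E := Real.exp ((c / 2) ^ 2 * t ^ 2 / 2)
    have hstep : ∀ᵐ r ∂ν, ∫ z, Real.exp (t * (f (Fin.cons z r) - m)) ∂Q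
        ≤ Real.exp (t * (h r - m)) * E := by
      filter_upwards [hs'] with r hr
      have h1 := mgf_le_of_ae_dist_le (hfr r) (fun z => hM _) 
        (s := {z | (Fin.cons z r : Fin (n + 1) → Z) ∈ s}) hr
        (fun z hz z' hz' => hc _ hz _ hz' 0 fun j hj => by
          induction j using Fin.cases with
          | zero => exact absurd rfl hj
          | succ j => simp) t
      calc ∫ z, Real.exp (t * (f (Fin.cons z r) - m)) ∂Q
          = ∫ z, Real.exp (t * (h r - m)) * Real.exp (t * (f (Fin.cons z r) - h r)) ∂Q := by
            congr! 2 with z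
            rw [← Real.exp_add]
            congr 1
            ring
        _ = Real.exp (t * (h r - m)) * ∫ z, Real.exp (t * (f (Fin.cons z r) - h r)) ∂Q :=
            integral_const_mul _ _
        _ ≤ _ := by gcongr
    have hint2 : Integrable (fun r => Real.exp (t * (h r - m)) * E) ν :=
      Integrable.mul_const (.of_bound (by fun_prop) _ (.of_forall fun r => hbd _ (hhM r))) _
    have hmono := integral_mono_of_nonneg
      (.of_forall fun r => integral_nonneg fun z => (Real.exp_pos _).le) hint2 hstep
    refine hmono.trans ?_
    rw [integral_mul_const]
    refine (mul_le_mul_of_nonneg_right ih (Real.exp_pos _).le).trans_eq ?_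
    rw [← Real.exp_add]
    congr 1
    push_cast
    ring

/-- McDiarmid's inequality for a bounded, a.e. measurable function. -/
lemma measure_ge_le_of_bounded_differences {n : ℕ} {c M : ℝ} {f : (Fin n → Z) → ℝ}
    (hf : AEMeasurable f (Measure.pi fun _ : Fin n => Q)) (hM : ∀ z, |f z| ≤ M)
    (hc : ∀ z z' i, (∀ j, j ≠ i → z j = z' j) → |f z - f z'| ≤ c) {t : ℝ} (ht : 0 ≤ t) :
    (Measure.pi fun _ : Fin n => Q).real
      {z | t ≤ f z - ∫ z, f z ∂(Measure.pi fun _ : Fin n => Q)} ≤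
      Real.exp (-t ^ 2 / (2 * (n * (c / 2) ^ 2))) := by
  set π := Measure.pi fun _ : Fin n => Q
  -- A measurable modification clipped to `[-M, M]`: it is bounded everywhere, but inherits bounded
  -- differences only on the conull set where it equals `f`.
  let g : (Fin n → Z) → ℝ := fun z => max (-M) (min M (hf.mk f z))
  have hM0 : 0 ≤ M := (abs_nonneg _).trans (hM (nonempty_of_isProbabilityMeasure π).some)
  have hg : Measurable g := by have := hf.measurable_mk; fun_prop
  have hgM : ∀ z, |g z| ≤ M := fun z => abs_le.2
    ⟨le_max_left _ _, max_le (by linarith) (min_le_left _ _)⟩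
  have hfg : f =ᵐ[π] g := by
    filter_upwards [hf.ae_eq_mk] with z hz
    have := abs_le.1 (hM z)
    simp only [g, ← hz]
    rw [min_eq_right this.2, max_eq_right this.1]
  have hint : ∫ z, f z ∂π = ∫ z, g z ∂π := integral_congr_ae hfg
  have hsub : HasSubgaussianMGF (fun z => g z - ∫ z, g z ∂π) ⟨n * (c / 2) ^ 2, by positivity⟩ π := by
    refine ⟨fun u => ?_, fun u => ?_⟩
    · refine .of_bound (by fun_prop) (Real.exp (|u| * (M + |∫ z, g z ∂π|))) (.of_forall fun z => ?_)
      rw [Real.norm_eq_abs, Real.abs_exp, Real.exp_le_exp]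
      refine (le_abs_self _).trans ?_
      rw [abs_mul]
      gcongr
      exact (abs_sub _ _).trans (by gcongr; exact hgM z)
    · exact integral_exp_le_of_bounded_differences hg hgM (s := {z | f z = g z}) hfg
        (fun z hz z' hz' i hi => by
        rw [← show f z = g z from hz, ← show f z' = g z' from hz']
        exact hc z z' i hi) u
  have := hsub.measure_ge_le ht
  refine (measureReal_congr ?_).trans_le this
  filter_upwards [hfg] with z hz
  change (t ≤ f z - _) = (t ≤ g z - _)
  rw [hz, hint]

end BoundedDifferences

/-! ### Suprema of empirical processes and symmetrization -/

/-- The supremum `sup_i ∑_m w_m φ_i(z_m)` over a family of functions. -/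
noncomputable def supSum {ι Z : Type*} (φ : ι → Z → ℝ) {n : ℕ} (w : Fin n → ℝ) (z : Fin n → Z) : ℝ :=
  ⨆ i, ∑ m, w m * φ i (z m)

section SupSum

variable {ι Z : Type*} {φ : ι → Z → ℝ} {M : ℝ} {n : ℕ}

lemma abs_sum_mul_le (hM : ∀ i z, |φ i z| ≤ M) (w : Fin n → ℝ) (z : Fin n → Z) (i : ι) :
    |∑ m, w m * φ i (z m)| ≤ ∑ m, |w m| * M := by
  refine (Finset.abs_sum_le_sum_abs _ _).trans (Finset.sum_le_sum fun m _ => ?_)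
  rw [abs_mul]
  gcongr
  exact hM _ _

lemma bddAbove_range_sum (hM : ∀ i z, |φ i z| ≤ M) (w : Fin n → ℝ) (z : Fin n → Z) :
    BddAbove (Set.range fun i => ∑ m, w m * φ i (z m)) :=
  ⟨∑ m, |w m| * M, by rintro _ ⟨i, rfl⟩; exact (abs_le.1 (abs_sum_mul_le hM w z i)).2⟩

lemma le_supSum (hM : ∀ i z, |φ i z| ≤ M) (w : Fin n → ℝ) (z : Fin n → Z) (i : ι) :
    ∑ m, w m * φ i (z m) ≤ supSum φ w z :=
  le_ciSup (bddAbove_range_sum hM w z) i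

variable [Nonempty ι]

lemma abs_supSum_le (hM : ∀ i z, |φ i z| ≤ M) (w : Fin n → ℝ) (z : Fin n → Z) :
    |supSum φ w z| ≤ ∑ m, |w m| * M := by
  have hab := fun i => abs_le.1 (abs_sum_mul_le hM w z i)
  refine abs_le.2 ⟨?_, ciSup_le fun i => (hab i).2⟩
  exact (hab (Classical.arbitrary ι)).1.trans (le_supSum hM w z _)

lemma supSum_sub_le {W a : ℝ} (hM : ∀ i z, |φ i z| ≤ M) (hW : ∀ i z z', |φ i z - φ i z'| ≤ W)
    {w : Fin n → ℝ} (hw : ∀ m, |w m| ≤ a) (z z' : Fin n → Z) (m : Fin n)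
    (h : ∀ j, j ≠ m → z j = z' j) : |supSum φ w z - supSum φ w z'| ≤ a * W := by
  have key : ∀ z z' : Fin n → Z, (∀ j, j ≠ m → z j = z' j) →
      supSum φ w z ≤ supSum φ w z' + a * W := by
    intro z z' h
    refine ciSup_le fun i => ?_
    have h1 := le_supSum hM w z' i
    have h2 : ∑ j, w j * φ i (z j) - ∑ j, w j * φ i (z' j) = w m * (φ i (z m) - φ i (z' m)) := by
      rw [← Finset.sum_sub_distrib, Finset.sum_eq_single m]
      · ring
      · intro j _ hj
        rw [h j hj, sub_self]
      · simp
    have h3 : w m * (φ i (z m) - φ i (z' m)) ≤ a * W := by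
      refine (le_abs_self _).trans ?_
      rw [abs_mul]
      exact mul_le_mul (hw m) (hW _ _ _) (abs_nonneg _) ((abs_nonneg _).trans (hw m))
    linarith
  have h1 := key z z' h
  have h2 := key z' z fun j hj => (h j hj).symm
  exact abs_le.2 ⟨by linarith, by linarith⟩

lemma coe_supSum (hM : ∀ i z, |φ i z| ≤ M) (w : Fin n → ℝ) (z : Fin n → Z) :
    ((supSum φ w z : ℝ) : EReal) = ⨆ i, ((∑ m, w m * φ i (z m) : ℝ) : EReal) :=
  Monotone.map_ciSup_of_continuousAt continuous_coe_real_ereal.continuousAt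
    EReal.coe_strictMono.monotone (bddAbove_range_sum hM w z)

variable [MeasurableSpace Z] {Q : Measure Z} [IsProbabilityMeasure Q]

/-- The concentration of the supremum of an empirical process around its mean. -/
lemma measure_supSum_ge_le {W a : ℝ} (hM : ∀ i z, |φ i z| ≤ M)
    (hW : ∀ i z z', |φ i z - φ i z'| ≤ W) {w : Fin n → ℝ} (hw : ∀ m, |w m| ≤ a)
    (hmeas : AEMeasurable (supSum φ w) (Measure.pi fun _ : Fin n => Q)) {t : ℝ} (ht : 0 ≤ t) :
    (Measure.pi fun _ : Fin n => Q).real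
      {z | t ≤ supSum φ w z - ∫ z, supSum φ w z ∂(Measure.pi fun _ : Fin n => Q)} ≤
      Real.exp (-t ^ 2 / (2 * (n * (a * W / 2) ^ 2))) :=
  measure_ge_le_of_bounded_differences hmeas (abs_supSum_le hM w)
    (fun z z' m h => supSum_sub_le hM hW hw z z' m h) ht

/-- The differences `f(x) - f(y)` of a family of functions. -/
def diffFamily (φ : ι → Z → ℝ) : ι → Z × Z → ℝ := fun i p => φ i p.1 - φ i p.2

omit [Nonempty ι] [MeasurableSpace Z] in
lemma abs_diffFamily_le (hM : ∀ i z, |φ i z| ≤ M) (i : ι) (p : Z × Z) :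
    |diffFamily φ i p| ≤ 2 * M := by
  refine (abs_sub _ _).trans ?_
  linarith [hM i p.1, hM i p.2]

omit [IsProbabilityMeasure Q] in
lemma measurePreserving_append [SigmaFinite Q] (n : ℕ) :
    MeasurePreserving (fun p : Fin n → Z × Z =>
        (Fin.append (fun m => (p m).1) (fun m => (p m).2) : Fin (n + n) → Z))
      (Measure.pi fun _ : Fin n => Q.prod Q) (Measure.pi fun _ : Fin (n + n) => Q) := by
  have hm : Measurable (fun p : Fin n → Z × Z =>
        (Fin.append (fun m => (p m).1) (fun m => (p m).2) : Fin (n + n) → Z)) := by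
    refine measurable_pi_iff.2 fun j => ?_
    induction j using Fin.addCases with
    | left j => simp only [Fin.append_left]; fun_prop
    | right j => simp only [Fin.append_right]; fun_prop
  refine ⟨hm, (Measure.pi_eq fun s hs => ?_).symm⟩
  rw [Measure.map_apply hm (.univ_pi hs), Fin.prod_univ_add, ← Finset.prod_mul_distrib]
  simp_rw [← Measure.prod_prod]
  rw [← Measure.pi_pi]
  congr 1
  ext p
  simp only [Set.mem_preimage, Set.mem_univ_pi, Set.mem_prod]
  constructor
  · intro h m
    have h1 := h (Fin.castAdd n m)
    have h2 := h (Fin.natAdd n m)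
    rw [Fin.append_left] at h1
    rw [Fin.append_right] at h2
    exact ⟨h1, h2⟩
  · intro h j
    induction j using Fin.addCases with
    | left j => rw [Fin.append_left]; exact (h j).1
    | right j => rw [Fin.append_right]; exact (h j).2

-- A sample of `n` pairs is a sample of size `2n` with weights `w` and `-w`; this is why
-- measurability is assumed for all sizes and weights.
omit [Nonempty ι] [IsProbabilityMeasure Q] in
lemma aemeasurable_supSum_diffFamily [SigmaFinite Q]
    (hmeas : ∀ (k : ℕ) (w : Fin k → ℝ), AEMeasurable (supSum φ w) (Measure.pi fun _ : Fin k => Q))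
    (w : Fin n → ℝ) :
    AEMeasurable (supSum (diffFamily φ) w) (Measure.pi fun _ : Fin n => Q.prod Q) := by
  have h := (hmeas (n + n) (Fin.append w (-w))).comp_quasiMeasurePreserving
    (measurePreserving_append n).quasiMeasurePreserving
  refine h.congr (.of_forall fun p => ?_)
  simp only [supSum, Function.comp, Fin.sum_univ_add, Fin.append_left, Fin.append_right, diffFamily]
  refine iSup_congr fun i => ?_
  rw [← Finset.sum_add_distrib]
  refine Finset.sum_congr rfl fun m _ => ?_
  rw [Pi.neg_apply]
  ring

/-- Swap the two entries of the pairs at which the sign is `-1`. -/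
def swapSigns (ε : Fin n → ℤˣ) (p : Fin n → Z × Z) : Fin n → Z × Z :=
  fun m => if ε m = 1 then p m else (p m).swap

omit [IsProbabilityMeasure Q] in
lemma measurePreserving_swapSigns [SigmaFinite Q] (ε : Fin n → ℤˣ) :
    MeasurePreserving (swapSigns (Z := Z) ε) (Measure.pi fun _ : Fin n => Q.prod Q)
      (Measure.pi fun _ : Fin n => Q.prod Q) := by
  refine measurePreserving_pi (fun _ => Q.prod Q) (fun _ => Q.prod Q)
    (f := fun m q => if ε m = 1 then q else q.swap) fun m => ?_
  by_cases h : ε m = 1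
  · simp only [h, if_true]
    exact MeasurePreserving.id _
  · simpa [h] using Measure.measurePreserving_swap

omit [Nonempty ι] [MeasurableSpace Z] in
lemma supSum_diffFamily_swapSigns (w : Fin n → ℝ) (ε : Fin n → ℤˣ) (p : Fin n → Z × Z) :
    supSum (diffFamily φ) w (swapSigns ε p)
      = supSum (diffFamily φ) (fun m => ((ε m : ℤ) : ℝ) * w m) p := by
  refine iSup_congr fun i => Finset.sum_congr rfl fun m _ => ?_
  rcases Int.units_eq_one_or (ε m) with h | h
  · simp [swapSigns, h]
  · have : (-1 : ℤˣ) ≠ 1 := by decide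
    simp [swapSigns, h, this, diffFamily]
    ring

lemma integrable_supSum (hM : ∀ i z, |φ i z| ≤ M) {w : Fin n → ℝ}
    (hmeas : AEMeasurable (supSum φ w) (Measure.pi fun _ : Fin n => Q)) :
    Integrable (supSum φ w) (Measure.pi fun _ : Fin n => Q) :=
  .of_bound hmeas.aestronglyMeasurable _ (.of_forall fun z => abs_supSum_le hM w z)

/-- Comparison of the empirical process with an independent copy of itself. -/
lemma integral_supSum_le_diffFamily (hM : ∀ i z, |φ i z| ≤ M) (hφ : ∀ i, Measurable (φ i))
    (h0 : ∀ i, ∫ z, φ i z ∂Q = 0)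
    (hmeas : ∀ (k : ℕ) (w : Fin k → ℝ), AEMeasurable (supSum φ w) (Measure.pi fun _ : Fin k => Q))
    (w : Fin n → ℝ) :
    ∫ z, supSum φ w z ∂(Measure.pi fun _ : Fin n => Q) ≤
      ∫ p, supSum (diffFamily φ) w p ∂(Measure.pi fun _ : Fin n => Q.prod Q) := by
  set π := Measure.pi fun _ : Fin n => Q
  have he := (measurePreserving_arrowProdEquivProdArrow Z Z (Fin n) (fun _ => Q) (fun _ => Q)).symm
  set e := MeasurableEquiv.arrowProdEquivProdArrow Z Z (Fin n)
  have hint := integrable_supSum (abs_diffFamily_le hM) (aemeasurable_supSum_diffFamily hmeas w)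
  have hint' : Integrable (fun q : (Fin n → Z) × (Fin n → Z) => supSum (diffFamily φ) w (e.symm q))
      (π.prod π) := he.integrable_comp_of_integrable hint
  rw [← he.integral_comp', integral_prod _ hint']
  refine integral_mono_ae (integrable_supSum hM (hmeas n w)) hint'.integral_prod_left ?_
  filter_upwards [hint'.prod_right_ae] with z hz
  -- Since `φ i` has mean zero, subtracting the independent copy and integrating it out changes
  -- nothing; the supremum then moves inside the integral.
  refine ciSup_le fun i => ?_
  have hi : ∀ m, Integrable (fun z' : Fin n → Z => φ i (z' m)) π := fun m =>
    .of_bound ((hφ i).comp (measurable_pi_apply m)).aestronglyMeasurable M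
      (.of_forall fun z' => hM i _)
  have hi0 : ∀ m, ∫ z', φ i (z' m) ∂π = 0 := fun m => by
    rw [← h0 i, ← (measurePreserving_eval (fun _ : Fin n => Q) m).map_eq,
      integral_map (measurable_pi_apply m).aemeasurable (hφ i).aestronglyMeasurable]
  have hi' : ∀ m, Integrable (fun z' : Fin n → Z => w m * (φ i (z m) - φ i (z' m))) π := fun m =>
    ((integrable_const _).sub (hi m)).const_mul _
  calc ∑ m, w m * φ i (z m) = ∫ z', ∑ m, w m * (φ i (z m) - φ i (z' m)) ∂π := by
        rw [integral_finsetSum _ fun m _ => hi' m]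
        refine Finset.sum_congr rfl fun m _ => ?_
        rw [integral_const_mul, integral_sub (integrable_const _) (hi m), hi0]
        simp
    _ ≤ _ := by
        refine integral_mono (integrable_finsetSum _ fun m _ => hi' m) hz fun z' => ?_
        exact le_supSum (abs_diffFamily_le hM) w (e.symm (z, z')) i

lemma ofReal_integral_le_lintegral {Y : Type*} [MeasurableSpace Y] {ν : Measure Y} {f : Y → ℝ}
    (hf : Integrable f ν) : ENNReal.ofReal (∫ y, f y ∂ν) ≤ ∫⁻ y, ENNReal.ofReal (f y) ∂ν := by
  rw [integral_eq_lintegral_pos_part_sub_lintegral_neg_part hf]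
  exact (ENNReal.ofReal_le_ofReal (sub_le_self _ ENNReal.toReal_nonneg)).trans ENNReal.ofReal_toReal_le

/-- Symmetrization: a pointwise bound for the Rademacher averages of the symmetrized process bounds
the mean of the supremum of the empirical process. -/
lemma ofReal_integral_supSum_le (hM : ∀ i z, |φ i z| ≤ M) (hφ : ∀ i, Measurable (φ i))
    (h0 : ∀ i, ∫ z, φ i z ∂Q = 0)
    (hmeas : ∀ (k : ℕ) (w : Fin k → ℝ), AEMeasurable (supSum φ w) (Measure.pi fun _ : Fin k => Q))
    (w : Fin n → ℝ) {a : (Fin n → Z) → ℝ≥0∞} (ha : AEMeasurable a (Measure.pi fun _ : Fin n => Q))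
    (hbound : ∀ᵐ p ∂(Measure.pi fun _ : Fin n => Q.prod Q), ENNReal.ofReal
      ((2 ^ n)⁻¹ * ∑ ε : Fin n → ℤˣ, supSum (diffFamily φ) (fun m => ((ε m : ℤ) : ℝ) * w m) p) ≤
        a (fun m => (p m).1) + a (fun m => (p m).2)) :
    ENNReal.ofReal (∫ z, supSum φ w z ∂(Measure.pi fun _ : Fin n => Q)) ≤
      2 * ∫⁻ z, a z ∂(Measure.pi fun _ : Fin n => Q) := by
  set π := Measure.pi fun _ : Fin n => Q
  set π₂ := Measure.pi fun _ : Fin n => Q.prod Q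
  have hmeas₂ := fun w : Fin n → ℝ => aemeasurable_supSum_diffFamily hmeas w
  have hint := fun w : Fin n → ℝ => integrable_supSum (abs_diffFamily_le hM) (hmeas₂ w)
  -- Swapping the entries of a pair preserves the law and flips the sign of the difference, so every
  -- sign pattern has the same mean.
  have hswap : ∀ ε : Fin n → ℤˣ,
      ∫ p, supSum (diffFamily φ) (fun m => ((ε m : ℤ) : ℝ) * w m) p ∂π₂
        = ∫ p, supSum (diffFamily φ) w p ∂π₂ := by
    intro ε
    have hs : MeasurePreserving _ π₂ π₂ := measurePreserving_swapSigns (Q := Q) ε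
    simp_rw [← supSum_diffFamily_swapSigns]
    conv_rhs => rw [← hs.map_eq]
    rw [integral_map hs.aemeasurable]
    rw [hs.map_eq]
    exact (hmeas₂ w).aestronglyMeasurable
  have havg : ∫ p, supSum (diffFamily φ) w p ∂π₂ = ∫ p, (2 ^ n)⁻¹ *
      ∑ ε : Fin n → ℤˣ, supSum (diffFamily φ) (fun m => ((ε m : ℤ) : ℝ) * w m) p ∂π₂ := by
    rw [integral_const_mul, integral_finsetSum _ fun ε _ => hint (fun m => ((ε m : ℤ) : ℝ) * w m),
      Finset.sum_congr rfl fun ε _ => hswap ε]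
    simp
  have hfst : MeasurePreserving (fun (p : Fin n → Z × Z) m => (p m).1) π₂ π :=
    measurePreserving_pi _ _ fun _ => measurePreserving_fst
  have hsnd : MeasurePreserving (fun (p : Fin n → Z × Z) m => (p m).2) π₂ π :=
    measurePreserving_pi _ _ fun _ => measurePreserving_snd
  calc ENNReal.ofReal (∫ z, supSum φ w z ∂π)
      ≤ ENNReal.ofReal (∫ p, supSum (diffFamily φ) w p ∂π₂) :=
        ENNReal.ofReal_le_ofReal (integral_supSum_le_diffFamily hM hφ h0 hmeas w)
    _ ≤ ∫⁻ p, (a (fun m => (p m).1) + a (fun m => (p m).2)) ∂π₂ := by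
        rw [havg]
        refine (ofReal_integral_le_lintegral ?_).trans (lintegral_mono_ae hbound)
        exact (integrable_finsetSum _ fun ε _ => hint _).const_mul _
    _ = 2 * ∫⁻ z, a z ∂π := by
        rw [lintegral_add_left' (f := fun p : Fin n → Z × Z => a fun m => (p m).1)
          (ha.comp_quasiMeasurePreserving hfst.quasiMeasurePreserving), two_mul]
        congr 1
        · rw [← hfst.map_eq, lintegral_map' (hfst.map_eq ▸ ha) hfst.aemeasurable]
        · rw [← hsnd.map_eq, lintegral_map' (hsnd.map_eq ▸ ha) hsnd.aemeasurable]

end SupSum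

/-! ### The law of complementary labels and unbiasedness -/

section CompMeasure

variable {X : Type*} [MeasurableSpace X] {K : ℕ}

/-- Double counting: each `k ≠ y` lies in `choose (K-2) (c-1)` of the sets, and `(K-1) choose (K-2)
(c-1) = c choose (K-1) c`. After weighting by `(K-1)/c`, every loss except that at `y` cancels. -/
lemma sum_compLoss_powersetCard (ℓ : EuclideanSpace ℝ (Fin K) → Fin K → ℝ) {c : ℕ}
    (hc : c ∈ Finset.Icc 1 (K - 1)) (u : EuclideanSpace ℝ (Fin K)) (y : Fin K) :
    (((K - 1).choose c : ℕ) : ℝ)⁻¹ *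
      ∑ Y ∈ Finset.powersetCard c (Finset.univ.erase y), compLoss ℓ c u Y = ℓ u y := by
  obtain ⟨hc1, hcK⟩ := Finset.mem_Icc.1 hc
  have hcard : (Finset.univ.erase y).card = K - 1 := by simp
  have hdouble : ∑ Y ∈ Finset.powersetCard c (Finset.univ.erase y), ∑ k ∈ Y, ℓ u k
      = ((K - 2).choose (c - 1) : ℕ) * ∑ k ∈ Finset.univ.erase y, ℓ u k := by
    rw [Finset.sum_comm' (t' := Finset.univ.erase y)
      (s' := fun k => {Y ∈ Finset.powersetCard c (Finset.univ.erase y) | {k} ⊆ Y}), Finset.mul_sum]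
    · refine Finset.sum_congr rfl fun k hk => ?_
      rw [Finset.sum_const, Finset.card_filter_powersetCard_subset _ _ _ (by simpa using hk)
        (by simpa using hc1), hcard]
      simp [Nat.sub_sub]
    · intro Y k
      simp only [Finset.mem_filter, Finset.singleton_subset_iff]
      constructor
      · rintro ⟨h1, h2⟩
        exact ⟨⟨h1, h2⟩, (Finset.mem_powersetCard.1 h1).1 h2⟩
      · exact fun h => h.1
  obtain ⟨d, rfl⟩ : ∃ d, c = d + 1 := ⟨c - 1, by omega⟩
  obtain ⟨N, rfl⟩ : ∃ N, K = N + 2 := ⟨K - 2, by omega⟩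
  simp only [compLoss]
  rw [Finset.sum_sub_distrib, ← Finset.mul_sum, hdouble, Finset.sum_const,
    Finset.card_powersetCard, hcard, ← Finset.add_sum_erase _ _ (Finset.mem_univ y)]
  have hchoose := Nat.add_one_mul_choose_eq N d
  have hpos : 0 < (N + 1).choose (d + 1) := Nat.choose_pos (by omega)
  simp only [Nat.add_sub_cancel, show N + 2 - 1 = N + 1 from rfl, nsmul_eq_mul]
  have hchoose' : ((N : ℝ) + 1) * (N.choose d : ℝ) = ((N + 1).choose (d + 1) : ℝ) * (d + 1) := by
    exact_mod_cast hchoose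
  have hpos' : (0 : ℝ) < ((N + 1).choose (d + 1) : ℕ) := by exact_mod_cast hpos
  generalize ∑ k ∈ Finset.univ.erase y, ℓ u k = T
  push_cast
  have : ((N : ℝ) + 2 - 1) / (d + 1) * ((N.choose d : ℝ) * T)
      = ((N + 1).choose (d + 1) : ℝ) * T := by
    field_simp
    linear_combination T * hchoose'
  rw [this]
  field_simp
  ring

variable {P : Measure (X × Fin K)} [IsProbabilityMeasure P]

/-- Exchanging the sums over `Y` and over `y ∉ Y` conditions on the true label, the only one whose
indicator survives. -/
lemma integral_compMeasure {c : ℕ} (hc : c ∈ Finset.Icc 1 (K - 1)) {F : X × Finset (Fin K) → ℝ}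
    (hF : Measurable F) {M : ℝ} (hM : ∀ z, |F z| ≤ M) :
    ∫ z, F z ∂(compMeasure P c) = ∫ z, (((K - 1).choose c : ℕ) : ℝ)⁻¹ *
      ∑ Y ∈ Finset.powersetCard c (Finset.univ.erase z.2), F (z.1, Y) ∂P := by
  have hpos : 0 < (K - 1).choose c := Nat.choose_pos (Finset.mem_Icc.1 hc).2
  have hsec : ∀ Y : Finset (Fin K), Measurable fun z : X × Fin K => (z.1, Y) := fun Y => by fun_prop
  have hS : ∀ y : Fin K, MeasurableSet (Prod.snd ⁻¹' {y} : Set (X × Fin K)) := fun y =>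
    measurable_snd (measurableSet_singleton y)
  have hint : ∀ Y y, Integrable F ((P.restrict (Prod.snd ⁻¹' {y})).map fun z => (z.1, Y)) :=
    fun Y y => .of_bound hF.aestronglyMeasurable M (.of_forall hM)
  have hint' : ∀ Y y, Integrable (Set.indicator (Prod.snd ⁻¹' {y}) fun z : X × Fin K => F (z.1, Y)) P :=
    fun Y y => Integrable.indicator (.of_bound (hF.comp (hsec Y)).aestronglyMeasurable M
      (.of_forall fun z => hM _)) (hS y)
  have hsum : ∀ Y, Integrable F (∑ y ∈ Yᶜ, (P.restrict (Prod.snd ⁻¹' {y})).map fun z => (z.1, Y)) :=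
    fun Y => integrable_finsetSum_measure.2 fun y _ => hint Y y
  rw [compMeasure, integral_finsetSum_measure fun Y _ => (hsum Y).smul_measure (by simp [hpos.ne'])]
  have h1 : ∀ Y : Finset (Fin K), ∫ z, F z ∂((((K - 1).choose c : ℕ) : ℝ≥0∞)⁻¹ •
      ∑ y ∈ Yᶜ, (P.restrict (Prod.snd ⁻¹' {y})).map fun z => (z.1, Y)) =
      ∫ z, (((K - 1).choose c : ℕ) : ℝ)⁻¹ *
        ∑ y ∈ Yᶜ, Set.indicator (Prod.snd ⁻¹' {y}) (fun z : X × Fin K => F (z.1, Y)) z ∂P := by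
    intro Y
    rw [integral_smul_measure, integral_finsetSum_measure fun y _ => hint Y y, integral_const_mul,
      integral_finsetSum _ fun y _ => hint' Y y, smul_eq_mul, ENNReal.toReal_inv,
      ENNReal.toReal_natCast]
    congr 1
    refine Finset.sum_congr rfl fun y _ => ?_
    rw [integral_map (hsec Y).aemeasurable hF.aestronglyMeasurable, integral_indicator (hS y)]
  rw [Finset.sum_congr rfl fun Y _ => h1 Y, ← integral_finsetSum _ fun Y _ =>
    (integrable_finsetSum _ fun y _ => hint' Y y).const_mul _]
  refine integral_congr_ae (.of_forall fun z => ?_)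
  simp only
  rw [← Finset.mul_sum]
  congr 1
  rw [Finset.sum_comm' (t' := Finset.univ)
    (s' := fun y => Finset.powersetCard c (Finset.univ.erase y))]
  · rw [Finset.sum_eq_single z.2]
    · simp [Set.indicator]
    · intro y _ hy
      exact Finset.sum_eq_zero fun Y _ => by simp [Set.indicator, hy.symm]
    · simp
  · intro Y y
    simp only [Finset.mem_powersetCard, Finset.mem_compl, Finset.subset_erase, Finset.mem_univ,
      Finset.subset_univ]
    tauto

/-- Each label is avoided by the same number of `c`-sets, and the normalization cancels it. Hence
all sample sizes refer to complexities under the one marginal `P.fst`. -/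
lemma fst_compMeasure {c : ℕ} (hc : c ∈ Finset.Icc 1 (K - 1))
    [IsProbabilityMeasure (compMeasure P c)] : (compMeasure P c).fst = P.fst := by
  have hpos : 0 < (K - 1).choose c := Nat.choose_pos (Finset.mem_Icc.1 hc).2
  refine Measure.ext fun A hA => ?_
  rw [← measureReal_eq_measureReal_iff, ← integral_indicator_one hA, ← integral_indicator_one hA,
    Measure.fst, Measure.fst, integral_map measurable_fst.aemeasurable
      (measurable_one.indicator hA).aestronglyMeasurable, integral_map measurable_fst.aemeasurable
      (measurable_one.indicator hA).aestronglyMeasurable,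
    integral_compMeasure hc (F := fun z => A.indicator 1 z.1)
      ((measurable_one.indicator hA).comp measurable_fst) (M := 1)]
  · refine integral_congr_ae (.of_forall fun z => ?_)
    have : (Finset.univ.erase z.2).card = K - 1 := by simp
    simp only [Finset.sum_const, Finset.card_powersetCard, this, nsmul_eq_mul]
    rw [← mul_assoc, inv_mul_cancel₀ (by exact_mod_cast hpos.ne'), one_mul]
  · intro z
    by_cases h : z.1 ∈ A <;> simp [h]

lemma ae_card_eq_compMeasure (P : Measure (X × Fin K)) (c : ℕ) :
    ∀ᵐ z ∂(compMeasure P c), z.2.card = c := by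
  have hm : MeasurableSet {z : X × Finset (Fin K) | ¬ z.2.card = c} :=
    measurable_snd (t := {Y : Finset (Fin K) | ¬ Y.card = c}) trivial
  rw [ae_iff, compMeasure, Measure.finsetSum_apply]
  refine Finset.sum_eq_zero fun Y hY => ?_
  rw [Measure.smul_apply, Measure.finsetSum_apply, Finset.sum_eq_zero, smul_zero]
  intro y _
  rw [Measure.map_apply (by fun_prop) hm]
  simp [(Finset.mem_powersetCard.1 hY).2]

/-- The multi-complementary loss is an unbiased estimate of the classification risk. -/
lemma integral_compLoss {ℓ : EuclideanSpace ℝ (Fin K) → Fin K → ℝ} {c : ℕ}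
    (hc : c ∈ Finset.Icc 1 (K - 1)) {g : X → EuclideanSpace ℝ (Fin K)} {M : ℝ}
    (hmeas : Measurable fun z : X × Finset (Fin K) => compLoss ℓ c (g z.1) z.2)
    (hM : ∀ x Y, |compLoss ℓ c (g x) Y| ≤ M) :
    ∫ z, compLoss ℓ c (g z.1) z.2 ∂(compMeasure P c) = risk P ℓ g := by
  rw [integral_compMeasure hc hmeas fun z => hM _ _]
  exact integral_congr_ae (.of_forall fun z => sum_compLoss_powersetCard ℓ hc (g z.1) z.2)

end CompMeasure

/-! ### Range and Lipschitz constant of the multi-complementary loss -/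

section CompLoss

variable {K : ℕ} {ℓ : EuclideanSpace ℝ (Fin K) → Fin K → ℝ}

/-- This separates the positive coefficients, off `Y`, from the nonpositive ones, on `Y`; range and
Lipschitz bounds are read off from it. -/
lemma compLoss_eq_sum (c : ℕ) (u : EuclideanSpace ℝ (Fin K)) (Y : Finset (Fin K)) :
    compLoss ℓ c u Y = ∑ y ∈ Yᶜ, ℓ u y - (((K : ℝ) - 1) / c - 1) * ∑ y ∈ Y, ℓ u y := by
  rw [compLoss, ← Finset.sum_add_sum_compl Y]
  ring

variable {c : ℕ}

lemma one_le_ratio (hc : c ∈ Finset.Icc 1 (K - 1)) : 1 ≤ ((K : ℝ) - 1) / c := by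
  obtain ⟨hc1, hcK⟩ := Finset.mem_Icc.1 hc
  have : (0 : ℝ) < c := by exact_mod_cast hc1
  rw [one_le_div this, le_sub_iff_add_le]
  have : c + 1 ≤ K := by omega
  exact_mod_cast this

/-- The absolute coefficients are `K - c` ones and `c` copies of `(K-1)/c - 1`; their sum is the
Lipschitz factor. -/
lemma compLoss_weight (hc : c ∈ Finset.Icc 1 (K - 1)) {Y : Finset (Fin K)} (hY : Y.card = c) (b : ℝ) :
    ∑ _y ∈ Yᶜ, b + (((K : ℝ) - 1) / c - 1) * ∑ _y ∈ Y, b = (2 * K - 1 - 2 * c) * b := by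
  obtain ⟨hc1, hcK⟩ := Finset.mem_Icc.1 hc
  have : (c : ℝ) ≠ 0 := by exact_mod_cast (by omega : c ≠ 0)
  rw [Finset.sum_const, Finset.sum_const, Finset.card_compl, hY, Fintype.card_fin, nsmul_eq_mul,
    nsmul_eq_mul, Nat.cast_sub (by omega)]
  field_simp
  ring

lemma compLoss_mem_Icc (hc : c ∈ Finset.Icc 1 (K - 1)) (Y : Finset (Fin K))
    {u : EuclideanSpace ℝ (Fin K)} {C : ℝ} (h0 : ∀ y, 0 ≤ ℓ u y) (hC : ∀ y, ℓ u y ≤ C) :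
    compLoss ℓ c u Y ∈ Set.Icc (-((((K : ℝ) - 1) / c - 1) * (K * C))) (K * C) := by
  have hr := sub_nonneg.2 (one_le_ratio hc)
  have hsum : ∀ Y : Finset (Fin K), 0 ≤ ∑ y ∈ Y, ℓ u y ∧ ∑ y ∈ Y, ℓ u y ≤ K * C := by
    intro Y
    refine ⟨Finset.sum_nonneg fun y _ => h0 y, ?_⟩
    calc ∑ y ∈ Y, ℓ u y ≤ ∑ y, ℓ u y :=
          Finset.sum_le_sum_of_subset_of_nonneg (Finset.subset_univ _) fun y _ _ => h0 y
      _ ≤ ∑ _y : Fin K, C := Finset.sum_le_sum fun y _ => hC y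
      _ = K * C := by simp
  rw [compLoss_eq_sum]
  have h1 := mul_le_mul_of_nonneg_left (hsum Y).2 hr
  have h2 := mul_nonneg hr (hsum Y).1
  have h3 := hsum Yᶜ
  constructor <;> linarith

lemma abs_compLoss_sub_le (hc : c ∈ Finset.Icc 1 (K - 1)) {Y : Finset (Fin K)} (hY : Y.card = c)
    {L : ℝ≥0} (hL : ∀ y, LipschitzWith L fun u => ℓ u y) (u v : EuclideanSpace ℝ (Fin K)) :
    |compLoss ℓ c u Y - compLoss ℓ c v Y| ≤ (2 * K - 1 - 2 * c) * L * ‖u - v‖ := by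
  rw [compLoss_eq_sum, compLoss_eq_sum, mul_assoc, ← compLoss_weight hc hY]
  have hr := one_le_ratio hc
  have hd : ∀ y, |ℓ u y - ℓ v y| ≤ L * ‖u - v‖ := fun y => by
    simpa [Real.dist_eq, dist_eq_norm] using (hL y).dist_le_mul u v
  have h1 := (Finset.abs_sum_le_sum_abs (fun y => ℓ u y - ℓ v y) Yᶜ).trans
    (Finset.sum_le_sum fun y _ => hd y)
  have h2 := mul_le_mul_of_nonneg_left ((Finset.abs_sum_le_sum_abs (fun y => ℓ u y - ℓ v y) Y).trans
    (Finset.sum_le_sum fun y _ => hd y)) (sub_nonneg.2 hr)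
  rw [← abs_of_nonneg (sub_nonneg.2 hr), ← abs_mul, abs_of_nonneg (sub_nonneg.2 hr)] at h2
  rw [Finset.sum_sub_distrib] at h1 h2
  refine le_trans ?_ (add_le_add h1 h2)
  refine le_trans (le_of_eq ?_) (abs_sub _ _)
  congr 1
  ring

end CompLoss

/-! ### Contraction in terms of the empirical Rademacher complexity -/

/-- One coordinate of a uniform tuple is uniform. The factor on the left avoids the exponent `K -
1`. -/
lemma card_mul_sum_eval {α : Type*} [Fintype α] (F : α → ℝ) : ∀ {K : ℕ} (k : Fin K),
    Fintype.card α * ∑ e : Fin K → α, F (e k) = (Fintype.card α : ℝ) ^ K * ∑ a, F a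
  | K + 1, k => by
    rw [sum_fin_cons]
    induction k using Fin.cases with
    | zero =>
      simp only [Fin.cons_zero, Finset.sum_const, Finset.card_univ, Fintype.card_fun,
        Fintype.card_fin, nsmul_eq_mul, ← Finset.mul_sum]
      push_cast
      ring
    | succ k =>
      simp only [Fin.cons_succ, Finset.sum_const, Finset.card_univ, nsmul_eq_mul]
      rw [card_mul_sum_eval F k]
      ring

lemma ofReal_sum_le {ι : Type*} (s : Finset ι) (f : ι → ℝ) :
    ENNReal.ofReal (∑ i ∈ s, f i) ≤ ∑ i ∈ s, ENNReal.ofReal (f i) :=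
  Finset.le_sum_of_subadditive _ ENNReal.ofReal_zero.le (fun _ _ => ENNReal.ofReal_add_le) _ _

lemma coe_sum {ι : Type*} (s : Finset ι) (f : ι → ℝ) :
    ((∑ i ∈ s, f i : ℝ) : EReal) = ∑ i ∈ s, (f i : EReal) :=
  map_sum (⟨⟨Real.toEReal, rfl⟩, EReal.coe_add⟩ : ℝ →+ EReal) f s

section Rademacher

variable {X : Type*} {G : Set (X → ℝ)} {n K : ℕ}

/-- Near-maximizers of a Rademacher average do not exceed the empirical Rademacher complexity. -/
lemma ofReal_sum_selection_le (x : Fin n → X) {h : (Fin n → ℤˣ) → X → ℝ} (hh : ∀ σ, h σ ∈ G) :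
    ENNReal.ofReal ((2 ^ n)⁻¹ * ∑ σ : Fin n → ℤˣ, (n : ℝ)⁻¹ * ∑ m, ((σ m : ℤ) : ℝ) * h σ (x m)) ≤
      empiricalRademacher G x := by
  rw [empiricalRademacher, ENNReal.ofReal_mul (by positivity), mul_comm, div_eq_mul_inv,
    ENNReal.ofReal_inv_of_pos (by positivity), ENNReal.ofReal_pow (by positivity),
    ENNReal.ofReal_ofNat]
  gcongr
  rw [← EReal.real_coe_toENNReal, coe_sum]
  exact EReal.toENNReal_le_toENNReal (Finset.sum_le_sum fun σ _ => le_biSup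
    (fun g : X → ℝ => (((n : ℝ)⁻¹ * ∑ i, ((σ i : ℤ) : ℝ) * g (x i) : ℝ) : EReal)) (hh σ))

/-- The vector contraction inequality, in terms of the empirical Rademacher complexity of the
class of coordinates. -/
lemma ofReal_sum_lipschitz_le (x : Fin n → X) {Λ : ℝ} (hΛ : 0 ≤ Λ)
    {ψ : Fin n → EuclideanSpace ℝ (Fin K) → ℝ} (hψ : ∀ m u v, |ψ m u - ψ m v| ≤ Λ * ‖u - v‖)
    {h : (Fin n → ℤˣ) → X → EuclideanSpace ℝ (Fin K)} (hh : ∀ ε, h ε ∈ productClass K G) :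
    ENNReal.ofReal ((2 ^ n)⁻¹ *
        ∑ ε : Fin n → ℤˣ, (n : ℝ)⁻¹ * ∑ m, ((ε m : ℤ) : ℝ) * ψ m (h ε (x m))) ≤
      ENNReal.ofReal (9 / 5 * Λ) * (K * empiricalRademacher G x) := by
  let V : Fin K → (Fin n → ℤˣ) → (Fin n → ℤˣ) → ℝ :=
    fun k σ i => ∑ m, ((σ m : ℤ) : ℝ) * h i (x m) k
  -- Each coordinate `k` gets its own maximizing index for each sign vector; this is harmless, as
  -- coordinates of all the `h i` lie in `G`.
  have hsel : ∀ k σ, ∃ i, V k σ i = ⨆ j, V k σ j := fun k σ => exists_eq_ciSup_of_finite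
  choose s hs using hsel
  have hcontr := vector_contraction hΛ (fun _ : Fin n → ℤˣ => 0) (fun m i => ψ m (h i (x m)))
    (fun m i => h i (x m)) (fun m i j => hψ m _ _)
  simp only [zero_add] at hcontr
  have hleft : ∑ ε : Fin n → ℤˣ, ∑ m, ((ε m : ℤ) : ℝ) * ψ m (h ε (x m)) ≤
      ∑ ε : Fin n → ℤˣ, ⨆ i, ∑ m, ((ε m : ℤ) : ℝ) * ψ m (h i (x m)) :=
    Finset.sum_le_sum fun ε _ =>
      le_ciSup_of_finite (fun i => ∑ m, ((ε m : ℤ) : ℝ) * ψ m (h i (x m))) ε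
  have hright : ∀ e : Fin n → Fin K → ℤˣ,
      (⨆ i, 9 / 5 * Λ * ∑ m, ∑ k, ((e m k : ℤ) : ℝ) * h i (x m) k) ≤
        9 / 5 * Λ * ∑ k, V k (fun m => e m k) (s k fun m => e m k) := by
    intro e
    refine ciSup_le fun i => ?_
    gcongr
    rw [Finset.sum_comm]
    gcongr with k _
    rw [hs]
    exact le_ciSup_of_finite (V k fun m => e m k) i
  have hcount : ∀ k, 2 ^ n * ∑ e : Fin n → Fin K → ℤˣ, V k (fun m => e m k) (s k fun m => e m k)
      = (2 ^ n) ^ K * ∑ σ, V k σ (s k σ) := by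
    intro k
    have := card_mul_sum_eval (fun σ : Fin n → ℤˣ => V k σ (s k σ)) k
    simp only [Fintype.card_fun, Fintype.card_fin, Fintype.card_units_int] at this
    push_cast at this
    rw [← this]
    congr 1
    exact Fintype.sum_equiv (Equiv.piComm _) _ _ fun _ => rfl
  have hmain : ∑ ε : Fin n → ℤˣ, ∑ m, ((ε m : ℤ) : ℝ) * ψ m (h ε (x m)) ≤
      9 / 5 * Λ * ∑ k, ∑ σ, V k σ (s k σ) := by
    have h1 := Finset.sum_le_sum fun e (_ : e ∈ Finset.univ) => hright e
    rw [← Finset.mul_sum, Finset.sum_comm] at h1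
    have h2 := mul_le_mul_of_nonneg_left h1 (show (0 : ℝ) ≤ 2 ^ n by positivity)
    have h4 : 2 ^ n * ∑ k, ∑ e : Fin n → Fin K → ℤˣ, V k (fun m => e m k) (s k fun m => e m k)
        = (2 ^ K) ^ n * ∑ k, ∑ σ, V k σ (s k σ) := by
      rw [Finset.mul_sum, Finset.sum_congr rfl fun k _ => hcount k, ← Finset.mul_sum, ← pow_mul,
        ← pow_mul, mul_comm n K]
    rw [mul_left_comm, h4, mul_left_comm] at h2
    have h3 := (mul_le_mul_of_nonneg_left hleft (show (0 : ℝ) ≤ (2 ^ K) ^ n by positivity)).trans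
      (hcontr.trans h2)
    exact le_of_mul_le_mul_left h3 (by positivity)
  calc _ ≤ ENNReal.ofReal (9 / 5 * Λ *
        ∑ k, (2 ^ n)⁻¹ * ∑ σ : Fin n → ℤˣ, (n : ℝ)⁻¹ * V k σ (s k σ)) := by
        refine ENNReal.ofReal_le_ofReal ?_
        simp only [← Finset.mul_sum]
        calc _ ≤ (2 ^ n : ℝ)⁻¹ * ((n : ℝ)⁻¹ * (9 / 5 * Λ * ∑ k, ∑ σ, V k σ (s k σ))) := by gcongr
          _ = _ := by ring
    _ ≤ ENNReal.ofReal (9 / 5 * Λ) * (K * empiricalRademacher G x) := by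
        rw [ENNReal.ofReal_mul (by positivity)]
        gcongr
        refine (ofReal_sum_le _ _).trans ?_
        refine (Finset.sum_le_sum fun k _ => ofReal_sum_selection_le x
          (h := fun σ x => h (s k σ) x k) fun σ => hh _ k).trans_eq ?_
        simp

variable [MeasurableSpace X]

lemma aemeasurable_empiricalRademacher {μ : Measure X} (h : HasMeasurableSuprema μ G) :
    AEMeasurable (fun x : Fin n → X => empiricalRademacher G x) (Measure.pi fun _ => μ) := by
  refine AEMeasurable.div_const (AEMeasurable.ereal_toENNReal ?_) _
  refine Finset.aemeasurable_fun_sum _ fun σ _ => ?_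
  simpa only [Finset.mul_sum, ← mul_assoc] using h n fun i => (n : ℝ)⁻¹ * ((σ i : ℤ) : ℝ)

end Rademacher

/-! ### Mean and tail bounds for the deviations -/

section Deviation

variable {X : Type*} [MeasurableSpace X] {K : ℕ}

/-- The functions of `deviationClass`, indexed by the decision functions. -/
noncomputable def deviation (P : Measure (X × Fin K)) (ℓ : EuclideanSpace ℝ (Fin K) → Fin K → ℝ)
    (G : Set (X → ℝ)) (c : ℕ) (g : productClass K G) (z : X × Finset (Fin K)) : ℝ :=
  risk P ℓ g.1 - compLoss ℓ c (g.1 z.1) z.2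

variable {P : Measure (X × Fin K)} [IsProbabilityMeasure P]
  {ℓ : EuclideanSpace ℝ (Fin K) → Fin K → ℝ} {G : Set (X → ℝ)} {C : ℝ} {L : ℝ≥0} {c n : ℕ}

lemma measurable_of_mem_productClass (hG : ∀ f ∈ G, Measurable f)
    {g : X → EuclideanSpace ℝ (Fin K)} (hg : g ∈ productClass K G) : Measurable g :=
  (WithLp.measurable_toLp 2 (Fin K → ℝ)).comp (measurable_pi_iff.2 fun k => hG _ (hg k))

lemma measurable_compLoss (hL : ∀ y, LipschitzWith L fun u => ℓ u y)
    {g : X → EuclideanSpace ℝ (Fin K)} (hg : Measurable g) :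
    Measurable fun z : X × Finset (Fin K) => compLoss ℓ c (g z.1) z.2 := by
  have : DiscreteMeasurableSpace (Finset (Fin K)) := ⟨fun _ => trivial⟩
  refine measurable_from_prod_countable_left fun Y => ?_
  have : ∀ y, Measurable fun x => ℓ (g x) y := fun y => (hL y).continuous.measurable.comp hg
  exact (Finset.measurable_fun_sum _ fun y _ => this y).sub
    ((Finset.measurable_fun_sum _ fun y _ => this y).const_mul _)

omit [IsProbabilityMeasure P] in
lemma abs_deviation_sub_le (hc : c ∈ Finset.Icc 1 (K - 1)) (h0 : ∀ u y, 0 ≤ ℓ u y)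
    (hC : ∀ g ∈ productClass K G, ∀ x y, ℓ (g x) y ≤ C) (hC0 : 0 ≤ C) (g : productClass K G)
    (z z' : X × Finset (Fin K)) :
    |deviation P ℓ G c g z - deviation P ℓ G c g z'| ≤ K * (((K : ℝ) - 1) / c + 1) * C := by
  have h1 := compLoss_mem_Icc hc z.2 (h0 (g.1 z.1)) (hC g.1 g.2 z.1)
  have h2 := compLoss_mem_Icc hc z'.2 (h0 (g.1 z'.1)) (hC g.1 g.2 z'.1)
  have : 0 ≤ (K : ℝ) * C := by positivity
  simp only [deviation]
  obtain ⟨h1, h1'⟩ := h1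
  obtain ⟨h2, h2'⟩ := h2
  exact abs_le.2 ⟨by linarith, by linarith⟩

omit [MeasurableSpace X] in
lemma abs_compLoss_le (hc : c ∈ Finset.Icc 1 (K - 1)) (h0 : ∀ u y, 0 ≤ ℓ u y)
    (hC : ∀ g ∈ productClass K G, ∀ x y, ℓ (g x) y ≤ C) (hC0 : 0 ≤ C)
    {g : X → EuclideanSpace ℝ (Fin K)} (hg : g ∈ productClass K G) (x : X) (Y : Finset (Fin K)) :
    |compLoss ℓ c (g x) Y| ≤ K * (((K : ℝ) - 1) / c + 1) * C := by
  obtain ⟨h1, h2⟩ := compLoss_mem_Icc hc Y (h0 (g x)) (hC g hg x)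
  have : 0 ≤ (K : ℝ) * C := by positivity
  have hr := one_le_ratio hc
  exact abs_le.2 ⟨by nlinarith, by nlinarith⟩

variable [IsProbabilityMeasure (compMeasure P c)]

lemma integral_deviation (hc : c ∈ Finset.Icc 1 (K - 1)) (hG : ∀ f ∈ G, Measurable f)
    (h0 : ∀ u y, 0 ≤ ℓ u y) (hC : ∀ g ∈ productClass K G, ∀ x y, ℓ (g x) y ≤ C) (hC0 : 0 ≤ C)
    (hL : ∀ y, LipschitzWith L fun u => ℓ u y) (g : productClass K G) :
    ∫ z, deviation P ℓ G c g z ∂(compMeasure P c) = 0 := by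
  have hm := measurable_compLoss (c := c) hL (measurable_of_mem_productClass hG g.2)
  have hb := abs_compLoss_le hc h0 hC hC0 g.2
  simp only [deviation]
  rw [integral_sub (integrable_const _) (.of_bound hm.aestronglyMeasurable _
    (.of_forall fun z => hb _ _)), integral_compLoss hc hm hb]
  simp

/-- A function of mean zero is bounded by its oscillation. -/
lemma abs_deviation_le (hc : c ∈ Finset.Icc 1 (K - 1)) (hG : ∀ f ∈ G, Measurable f)
    (h0 : ∀ u y, 0 ≤ ℓ u y) (hC : ∀ g ∈ productClass K G, ∀ x y, ℓ (g x) y ≤ C) (hC0 : 0 ≤ C)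
    (hL : ∀ y, LipschitzWith L fun u => ℓ u y) (g : productClass K G) (z : X × Finset (Fin K)) :
    |deviation P ℓ G c g z| ≤ K * (((K : ℝ) - 1) / c + 1) * C := by
  have hm := measurable_compLoss (c := c) hL (measurable_of_mem_productClass hG g.2)
  have hb := abs_compLoss_le hc h0 hC hC0 g.2
  have hint : Integrable (deviation P ℓ G c g) (compMeasure P c) :=
    (integrable_const _).sub (.of_bound hm.aestronglyMeasurable _ (.of_forall fun z => hb _ _))
  have := norm_integral_le_of_norm_le_const (μ := compMeasure P c)
    (f := fun z' => deviation P ℓ G c g z - deviation P ℓ G c g z')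
    (.of_forall fun z' => abs_deviation_sub_le hc h0 hC hC0 g z z')
  rw [integral_sub (integrable_const _) hint, integral_deviation hc hG h0 hC hC0 hL] at this
  simpa using this

omit [IsProbabilityMeasure P] [IsProbabilityMeasure (compMeasure P c)] in
lemma aemeasurable_supSum_deviation [Nonempty (productClass K G)] {M : ℝ}
    (hM : ∀ g z, |deviation P ℓ G c g z| ≤ M)
    (hdev : HasMeasurableSuprema (compMeasure P c) (deviationClass P ℓ G c)) (w : Fin n → ℝ) :
    AEMeasurable (supSum (deviation P ℓ G c) w) (Measure.pi fun _ : Fin n => compMeasure P c) := by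
  refine (hdev n w).ereal_toReal.congr (.of_forall fun z => ?_)
  simp only
  rw [deviationClass, iSup_image, iSup_subtype']
  exact (congrArg EReal.toReal (coe_supSum hM w z)).symm.trans (EReal.toReal_coe _)

lemma lintegral_empiricalRademacher_fst (hc : c ∈ Finset.Icc 1 (K - 1))
    (hGsup : HasMeasurableSuprema P.fst G) :
    AEMeasurable (fun z : Fin n → X × Finset (Fin K) => empiricalRademacher G fun m => (z m).1)
      (Measure.pi fun _ => compMeasure P c) ∧
    ∫⁻ z, empiricalRademacher G (fun m => (z m).1) ∂(Measure.pi fun _ : Fin n => compMeasure P c)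
      = rademacher P.fst G n := by
  have hp : MeasurePreserving (fun (z : Fin n → X × Finset (Fin K)) m => (z m).1)
      (Measure.pi fun _ => compMeasure P c) (Measure.pi fun _ => P.fst) :=
    measurePreserving_pi _ _ fun _ => ⟨measurable_fst, fst_compMeasure hc⟩
  have hm := aemeasurable_empiricalRademacher (n := n) hGsup
  refine ⟨hm.comp_quasiMeasurePreserving hp.quasiMeasurePreserving, ?_⟩
  rw [rademacher, ← hp.map_eq, lintegral_map' (hp.map_eq ▸ hm) hp.aemeasurable]

lemma weight_nonneg (hc : c ∈ Finset.Icc 1 (K - 1)) : (0 : ℝ) ≤ 2 * K - 1 - 2 * c := by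
  obtain ⟨hc1, hcK⟩ := Finset.mem_Icc.1 hc
  have : (c : ℝ) + 1 ≤ K := by exact_mod_cast (by omega : c + 1 ≤ K)
  linarith

/-- The Rademacher bound for the mean of the suprema of the deviations, for both signs `τ`. -/
lemma ofReal_integral_supSum_deviation_le [Nonempty (productClass K G)]
    (hc : c ∈ Finset.Icc 1 (K - 1)) (hG : ∀ f ∈ G, Measurable f)
    (h0 : ∀ u y, 0 ≤ ℓ u y) (hC : ∀ g ∈ productClass K G, ∀ x y, ℓ (g x) y ≤ C) (hC0 : 0 ≤ C)
    (hL : ∀ y, LipschitzWith L fun u => ℓ u y) (hGsup : HasMeasurableSuprema P.fst G)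
    (hdev : HasMeasurableSuprema (compMeasure P c) (deviationClass P ℓ G c)) {τ : ℝ}
    (hτ : |τ| = 1) :
    ENNReal.ofReal (∫ z, supSum (deviation P ℓ G c) (fun _ => τ / n) z
        ∂(Measure.pi fun _ : Fin n => compMeasure P c)) ≤
      2 * (ENNReal.ofReal (9 / 5 * ((2 * K - 1 - 2 * c) * L)) * (K * rademacher P.fst G n)) := by
  set Λ : ℝ := (2 * K - 1 - 2 * c) * L
  have hΛ : 0 ≤ Λ := mul_nonneg (weight_nonneg hc) L.2
  have hM := abs_deviation_le (P := P) hc hG h0 hC hC0 hL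
  obtain ⟨ham, hai⟩ := lintegral_empiricalRademacher_fst (n := n) (P := P) hc hGsup
  have hφ : ∀ g, Measurable (deviation P ℓ G c g) := fun g =>
    (measurable_compLoss hL (measurable_of_mem_productClass hG g.2)).const_sub _
  refine (ofReal_integral_supSum_le hM hφ (integral_deviation hc hG h0 hC hC0 hL)
    (fun k w => aemeasurable_supSum_deviation hM hdev w) (fun _ => τ / n)
    ((ham.const_mul K).const_mul (ENNReal.ofReal (9 / 5 * Λ))) ?_).trans_eq ?_
  swap
  · rw [lintegral_const_mul'' _ (ham.const_mul _), lintegral_const_mul'' _ ham, hai]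
  -- The Lipschitz factor `2K - 1 - 2c` requires label sets of size exactly `c`, which is an almost
  -- sure property.
  have hcard : ∀ᵐ p ∂(Measure.pi fun _ : Fin n => (compMeasure P c).prod (compMeasure P c)),
      ∀ m, (p m).1.2.card = c ∧ (p m).2.2.card = c := by
    refine ae_all_iff.2 fun m => (measurePreserving_eval
      (fun _ : Fin n => (compMeasure P c).prod (compMeasure P c)) m).quasiMeasurePreserving.ae
      (p := fun q => q.1.2.card = c ∧ q.2.2.card = c) ?_
    exact (measurePreserving_fst.quasiMeasurePreserving.ae (ae_card_eq_compMeasure P c)).and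
      (measurePreserving_snd.quasiMeasurePreserving.ae (ae_card_eq_compMeasure P c))
  filter_upwards [hcard] with p hp
  have hlip : ∀ (s : ℝ), |s| = 1 → ∀ (Y : Finset (Fin K)), Y.card = c →
      ∀ u v, |s * compLoss ℓ c u Y - s * compLoss ℓ c v Y| ≤ Λ * ‖u - v‖ := by
    intro s hs Y hY u v
    rw [← mul_sub, abs_mul, hs, one_mul]
    exact abs_compLoss_sub_le hc hY hL u v
  -- The suprema need not be attained, so each sign pattern gets a function within `η` of its
  -- supremum.
  refine ENNReal.le_of_forall_pos_le_add fun η hη _ => ?_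
  have hsel : ∀ ε : Fin n → ℤˣ, ∃ g : productClass K G,
      supSum (diffFamily (deviation P ℓ G c)) (fun m => ((ε m : ℤ) : ℝ) * (τ / n)) p - η <
        ∑ m, ((ε m : ℤ) : ℝ) * (τ / n) * diffFamily (deviation P ℓ G c) g (p m) := fun ε =>
    exists_lt_of_lt_ciSup (sub_lt_self _ (by exact_mod_cast hη))
  choose g hg using hsel
  -- The risk cancels in a difference of deviations, leaving minus the loss at the first entry and
  -- plus the loss at the second; hence the signs `-τ` and `τ`.
  have hb1 := ofReal_sum_lipschitz_le (fun m => (p m).1.1) hΛ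
    (ψ := fun m u => -τ * compLoss ℓ c u (p m).1.2)
    (fun m u v => hlip (-τ) (by rwa [abs_neg]) _ (hp m).1 u v) fun ε => (g ε).2
  have hb2 := ofReal_sum_lipschitz_le (fun m => (p m).2.1) hΛ
    (ψ := fun m u => τ * compLoss ℓ c u (p m).2.2)
    (fun m u v => hlip τ hτ _ (hp m).2 u v) fun ε => (g ε).2
  have hsum : (2 ^ n : ℝ)⁻¹ * ∑ ε : Fin n → ℤˣ,
      supSum (diffFamily (deviation P ℓ G c)) (fun m => ((ε m : ℤ) : ℝ) * (τ / n)) p ≤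
      (2 ^ n)⁻¹ * (∑ ε : Fin n → ℤˣ, (n : ℝ)⁻¹ *
        ∑ m, ((ε m : ℤ) : ℝ) * (-τ * compLoss ℓ c ((g ε).1 (p m).1.1) (p m).1.2)) +
      (2 ^ n)⁻¹ * (∑ ε : Fin n → ℤˣ, (n : ℝ)⁻¹ *
        ∑ m, ((ε m : ℤ) : ℝ) * (τ * compLoss ℓ c ((g ε).1 (p m).2.1) (p m).2.2)) + η := by
    have hη' : (η : ℝ) = (2 ^ n)⁻¹ * ∑ _ε : Fin n → ℤˣ, (η : ℝ) := by simp
    rw [hη', ← mul_add, ← mul_add, ← Finset.sum_add_distrib, ← Finset.sum_add_distrib]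
    refine mul_le_mul_of_nonneg_left (Finset.sum_le_sum fun ε _ => ?_) (by positivity)
    refine (sub_le_iff_le_add.1 (hg ε).le).trans_eq ?_
    congr 1
    rw [← mul_add, ← Finset.sum_add_distrib, Finset.mul_sum]
    refine Finset.sum_congr rfl fun m _ => ?_
    simp only [diffFamily, deviation]
    ring
  refine (ENNReal.ofReal_le_ofReal hsum).trans ?_
  refine ENNReal.ofReal_add_le.trans (add_le_add (ENNReal.ofReal_add_le.trans
    (add_le_add hb1 hb2)) ?_)
  simp

/-- The tail bound for the suprema of the deviations. -/
lemma measure_supSum_deviation_ge_le [Nonempty (productClass K G)]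
    (hc : c ∈ Finset.Icc 1 (K - 1)) (hG : ∀ f ∈ G, Measurable f)
    (h0 : ∀ u y, 0 ≤ ℓ u y) (hC : ∀ g ∈ productClass K G, ∀ x y, ℓ (g x) y ≤ C) (hC0 : 0 < C)
    (hL : ∀ y, LipschitzWith L fun u => ℓ u y)
    (hdev : HasMeasurableSuprema (compMeasure P c) (deviationClass P ℓ G c)) {τ : ℝ}
    (hτ : |τ| = 1) (hn : 0 < n) {δ : ℝ} (hδ : 0 < δ) (hδ1 : δ ≤ 1) :
    (Measure.pi fun _ : Fin n => compMeasure P c)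
      {z | K * (((K : ℝ) - 1) / c + 1) * C * √(Real.log (2 * K / δ) / (2 * n)) ≤
        supSum (deviation P ℓ G c) (fun _ => τ / n) z -
          ∫ z, supSum (deviation P ℓ G c) (fun _ => τ / n) z
            ∂(Measure.pi fun _ : Fin n => compMeasure P c)} ≤ ENNReal.ofReal (δ / (2 * K)) := by
  obtain ⟨hc1, hcK⟩ := Finset.mem_Icc.1 hc
  have hK : (1 : ℝ) ≤ K := by exact_mod_cast (by omega : 1 ≤ K)
  have hr := one_le_ratio hc
  have hn' : (0 : ℝ) < n := by exact_mod_cast hn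
  set W := K * (((K : ℝ) - 1) / c + 1) * C
  have hW : 0 < W := by positivity
  have hM := abs_deviation_le (P := P) hc hG h0 hC hC0.le hL
  have hlog : 0 ≤ Real.log (2 * K / δ) := Real.log_nonneg ((one_le_div hδ).2 (by linarith))
  have htail := measure_supSum_ge_le hM
    (abs_deviation_sub_le hc h0 hC hC0.le) (w := fun _ : Fin n => τ / n) (a := (n : ℝ)⁻¹)
    (fun m => by rw [abs_div, hτ, one_div, Nat.abs_cast])
    (aemeasurable_supSum_deviation hM hdev _)
    (t := W * √(Real.log (2 * K / δ) / (2 * n))) (by positivity)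
  rw [ENNReal.le_ofReal_iff_toReal_le (measure_ne_top _ _) (by positivity)]
  refine htail.trans_eq ?_
  rw [mul_pow, Real.sq_sqrt (by positivity)]
  -- Differences `W / n` give variance proxy `W² / (4n)`, so the chosen threshold makes the exponent
  -- exactly `-log (2K/δ)`.
  have : -(W ^ 2 * (Real.log (2 * K / δ) / (2 * n))) / (2 * (n * ((n : ℝ)⁻¹ * W / 2) ^ 2))
      = -Real.log (2 * K / δ) := by
    field_simp
  rw [this, ← Real.log_inv, Real.exp_log (by positivity), inv_div]

end Deviation

/-! ### Excess risk, constants and the parametric rate -/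

section Final

variable {X : Type*} [MeasurableSpace X] {K : ℕ} {P : Measure (X × Fin K)}
  {ℓ : EuclideanSpace ℝ (Fin K) → Fin K → ℝ} {G : Set (X → ℝ)} {α : ℕ → ℝ} {n : ℕ → ℕ}

lemma risk_sub_empiricalRisk (hα1 : ∑ c ∈ Finset.Icc 1 (K - 1), α c = 1)
    (hn : ∀ c ∈ Finset.Icc 1 (K - 1), 0 < n c) (s : (c : ℕ) → Fin (n c) → X × Finset (Fin K))
    (g : productClass K G) :
    risk P ℓ g.1 - empiricalRisk ℓ α n s g.1 =
      ∑ c ∈ Finset.Icc 1 (K - 1), α c * ∑ m, (n c : ℝ)⁻¹ * deviation P ℓ G c g (s c m) := by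
  rw [← one_mul (risk P ℓ g.1), ← hα1, Finset.sum_mul, empiricalRisk, ← Finset.sum_sub_distrib]
  refine Finset.sum_congr rfl fun c hc => ?_
  have : (n c : ℝ) ≠ 0 := by exact_mod_cast (hn c hc).ne'
  simp only [deviation]
  rw [← Finset.mul_sum, Finset.sum_sub_distrib, Finset.sum_const, Finset.card_univ,
    Fintype.card_fin, nsmul_eq_mul]
  field_simp

/-- The excess risk of an empirical minimizer is at most the sum of the two uniform deviations. -/
lemma risk_sub_risk_le (hα0 : ∀ c ∈ Finset.Icc 1 (K - 1), 0 ≤ α c)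
    (hα1 : ∑ c ∈ Finset.Icc 1 (K - 1), α c = 1)
    (hn : ∀ c ∈ Finset.Icc 1 (K - 1), 0 < n c) (s : (c : ℕ) → Fin (n c) → X × Finset (Fin K))
    {M : ℕ → ℝ} (hM : ∀ c ∈ Finset.Icc 1 (K - 1), ∀ g z, |deviation P ℓ G c g z| ≤ M c)
    {ghat gstar : X → EuclideanSpace ℝ (Fin K)} (hgstar : gstar ∈ productClass K G)
    (hghat : IsMinimizer (empiricalRisk ℓ α n s) (productClass K G) ghat) :
    risk P ℓ ghat - risk P ℓ gstar ≤ ∑ c ∈ Finset.Icc 1 (K - 1),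
      α c * (supSum (deviation P ℓ G c) (fun _ => 1 / n c) (s c) +
        supSum (deviation P ℓ G c) (fun _ => -1 / n c) (s c)) := by
  have h1 := risk_sub_empiricalRisk (P := P) (ℓ := ℓ) hα1 hn s ⟨ghat, hghat.1⟩
  have h2 := risk_sub_empiricalRisk (P := P) (ℓ := ℓ) hα1 hn s ⟨gstar, hgstar⟩
  have h3 : empiricalRisk ℓ α n s ghat ≤ empiricalRisk ℓ α n s gstar := hghat.2 hgstar
  -- Empirical minimality of `ghat` enters here. Weight `1/n` then controls the deviation at `ghat`,
  -- weight `-1/n` the one at `gstar`.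
  have h4 : risk P ℓ ghat - risk P ℓ gstar ≤
      (risk P ℓ ghat - empiricalRisk ℓ α n s ghat) - (risk P ℓ gstar - empiricalRisk ℓ α n s gstar) := by
    linarith
  refine h4.trans ?_
  rw [h1, h2, ← Finset.sum_sub_distrib]
  refine Finset.sum_le_sum fun c hc => ?_
  rw [← mul_sub]
  refine mul_le_mul_of_nonneg_left ?_ (hα0 c hc)
  rw [sub_eq_add_neg, ← Finset.sum_neg_distrib]
  refine add_le_add ((le_of_eq ?_).trans (le_supSum (hM c hc) _ (s c) ⟨ghat, hghat.1⟩))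
    ((le_of_eq ?_).trans (le_supSum (hM c hc) _ (s c) ⟨gstar, hgstar⟩))
  · simp
  · simp [div_eq_mul_inv]

/-- With `K = c + 1 + m`, the difference of the sides times `c` is `2c² + m² - (3/5) c m + c/5 + m`.
-/
lemma weight_mul_le {c : ℕ} (hc : c ∈ Finset.Icc 1 (K - 1)) :
    9 / 5 * (2 * (K : ℝ) - 1 - 2 * c) ≤ K * (((K : ℝ) - 1) / c + 1) := by
  obtain ⟨hc1, hcK⟩ := Finset.mem_Icc.1 hc
  have h1 : (1 : ℝ) ≤ c := by exact_mod_cast hc1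
  obtain ⟨m, rfl⟩ : ∃ m, K = c + 1 + m := ⟨K - (c + 1), by omega⟩
  have hm : (0 : ℝ) ≤ m := m.cast_nonneg
  rw [div_add_one (by positivity), mul_div_assoc', le_div_iff₀ (by positivity)]
  push_cast
  nlinarith [sq_nonneg ((m : ℝ) - c), mul_nonneg hm (zero_le_one.trans h1)]

/-- One summand of the estimation error bound. -/
lemma ofReal_summand_le {c : ℕ} (hc : c ∈ Finset.Icc 1 (K - 1)) {a t C R D₁ D₂ E₁ E₂ : ℝ} {L : ℝ≥0}
    {ρ : ℝ≥0∞} (ha : 0 ≤ a)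
    (hE₁ : ENNReal.ofReal E₁ ≤
      2 * (ENNReal.ofReal (9 / 5 * ((2 * K - 1 - 2 * c) * L)) * (K * ρ)))
    (hE₂ : ENNReal.ofReal E₂ ≤
      2 * (ENNReal.ofReal (9 / 5 * ((2 * K - 1 - 2 * c) * L)) * (K * ρ)))
    (ht : t = K * (((K : ℝ) - 1) / c + 1) * C * R)
    (hD₁ : D₁ - E₁ ≤ t) (hD₂ : D₂ - E₂ ≤ t) :
    ENNReal.ofReal (a * (D₁ + D₂)) ≤ ENNReal.ofReal (2 * K * (((K : ℝ) - 1) / c + 1) * a) *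
      (2 * K * L * ρ + ENNReal.ofReal (C * R)) := by
  have hr := one_le_ratio hc
  set W : ℝ := K * (((K : ℝ) - 1) / c + 1)
  have hW : 0 ≤ W := by positivity
  have hA : ENNReal.ofReal (9 / 5 * ((2 * K - 1 - 2 * c) * L)) * (K * ρ)
      ≤ ENNReal.ofReal W * (K * L * ρ) := by
    have : ENNReal.ofReal (9 / 5 * ((2 * K - 1 - 2 * c) * L)) ≤ ENNReal.ofReal W * L := by
      rw [← ENNReal.ofReal_coe_nnreal, ← ENNReal.ofReal_mul hW]
      refine ENNReal.ofReal_le_ofReal ?_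
      rw [← mul_assoc]
      exact mul_le_mul_of_nonneg_right (weight_mul_le hc) L.2
    calc _ ≤ ENNReal.ofReal W * L * (K * ρ) := by gcongr
      _ = _ := by ring
  have ht' : ENNReal.ofReal t = ENNReal.ofReal W * ENNReal.ofReal (C * R) := by
    rw [← ENNReal.ofReal_mul hW, ht, mul_assoc]
  have hD : ∀ {D E : ℝ}, ENNReal.ofReal E ≤
      2 * (ENNReal.ofReal (9 / 5 * ((2 * K - 1 - 2 * c) * L)) * (K * ρ)) → D - E ≤ t →
      ENNReal.ofReal D ≤ 2 * (ENNReal.ofReal W * (K * L * ρ)) +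
        ENNReal.ofReal W * ENNReal.ofReal (C * R) := by
    intro D E hE hDE
    calc ENNReal.ofReal D ≤ ENNReal.ofReal (E + t) := ENNReal.ofReal_le_ofReal (by linarith)
      _ ≤ ENNReal.ofReal E + ENNReal.ofReal t := ENNReal.ofReal_add_le
      _ ≤ _ := by
        rw [ht']
        gcongr
        exact hE.trans (by gcongr)
  calc ENNReal.ofReal (a * (D₁ + D₂)) ≤ ENNReal.ofReal a * (ENNReal.ofReal D₁ + ENNReal.ofReal D₂) := by
        rw [ENNReal.ofReal_mul ha]
        gcongr
        exact ENNReal.ofReal_add_le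
    _ ≤ ENNReal.ofReal a * ((2 * (ENNReal.ofReal W * (K * L * ρ)) +
        ENNReal.ofReal W * ENNReal.ofReal (C * R)) + (2 * (ENNReal.ofReal W * (K * L * ρ)) +
        ENNReal.ofReal W * ENNReal.ofReal (C * R))) := by
        gcongr
        exacts [hD hE₁ hD₁, hD hE₂ hD₂]
    _ = ENNReal.ofReal (2 * W * a) * (2 * K * L * ρ + ENNReal.ofReal (C * R)) := by
        rw [ENNReal.ofReal_mul (p := 2 * W) (by positivity), ENNReal.ofReal_mul (p := 2) zero_le_two,
          ENNReal.ofReal_ofNat]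
        ring
    _ = _ := by rw [show 2 * W * a = 2 * K * (((K : ℝ) - 1) / c + 1) * a by ring]

/-- The parametric rate, deduced from the estimation error bound. -/
lemma parametric_rate {C D T B : ℝ} {L : ℝ≥0} {ρ : ℕ → ℝ≥0∞} (hC : 0 ≤ C) (hB : 0 ≤ B)
    (hα0 : ∀ c ∈ Finset.Icc 1 (K - 1), 0 ≤ α c) (hα1 : ∑ c ∈ Finset.Icc 1 (K - 1), α c = 1)
    (hn : ∀ c ∈ Finset.Icc 1 (K - 1), 0 < n c)
    (hD : ENNReal.ofReal D ≤ ∑ c ∈ Finset.Icc 1 (K - 1),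
      ENNReal.ofReal (2 * K * (((K : ℝ) - 1) / c + 1) * α c) *
        (2 * K * L * ρ (n c) + ENNReal.ofReal (C * √(T / (2 * n c)))))
    (hρ : ∀ m : ℕ, 0 < m → ρ m ≤ ENNReal.ofReal (B / √m)) :
    D ≤ 2 * K ^ 2 * (2 * K * L * B + C * √(T / 2)) * ∑ c ∈ Finset.Icc 1 (K - 1), 1 / √(n c) := by
  have hL : (0 : ℝ) ≤ L := L.2
  have hterm : ∀ c ∈ Finset.Icc 1 (K - 1),
      ENNReal.ofReal (2 * K * (((K : ℝ) - 1) / c + 1) * α c) *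
        (2 * K * L * ρ (n c) + ENNReal.ofReal (C * √(T / (2 * n c)))) ≤
      ENNReal.ofReal (2 * K ^ 2 * (2 * K * L * B + C * √(T / 2)) * (1 / √(n c))) := by
    intro c hc
    have hr := one_le_ratio hc
    obtain ⟨hc1, hcK⟩ := Finset.mem_Icc.1 hc
    have h1 : (1 : ℝ) ≤ c := by exact_mod_cast hc1
    have hK : (1 : ℝ) ≤ K := by exact_mod_cast (by omega : 1 ≤ K)
    have hα : α c ≤ 1 := hα1 ▸ Finset.single_le_sum hα0 hc
    have hsqrt : √(T / (2 * n c)) = √(T / 2) * (1 / √(n c)) := by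
      rw [← div_div, Real.sqrt_div' _ (by positivity), div_eq_mul_one_div]
    have hsum : 2 * K * L * ρ (n c) + ENNReal.ofReal (C * √(T / (2 * n c))) ≤
        ENNReal.ofReal ((2 * K * L * B + C * √(T / 2)) * (1 / √(n c))) := by
      calc _ ≤ 2 * K * L * ENNReal.ofReal (B / √(n c)) + ENNReal.ofReal (C * √(T / (2 * n c))) := by
            gcongr
            exact hρ _ (hn c hc)
        _ = ENNReal.ofReal (2 * K * L * (B / √(n c)) + C * √(T / (2 * n c))) := by
            rw [ENNReal.ofReal_add (by positivity) (by positivity),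
              ENNReal.ofReal_mul (p := 2 * K * L) (by positivity),
              ENNReal.ofReal_mul (p := 2 * K) (by positivity), ENNReal.ofReal_mul zero_le_two]
            simp
        _ = _ := by
            rw [hsqrt]
            congr 1
            ring
    refine (mul_le_mul_right hsum _).trans ?_
    rw [← ENNReal.ofReal_mul (by have := hα0 c hc; positivity), mul_assoc (2 * (K : ℝ) ^ 2)]
    refine ENNReal.ofReal_le_ofReal (mul_le_mul_of_nonneg_right ?_ (by positivity))
    have hdiv : ((K : ℝ) - 1) / c ≤ K - 1 := div_le_self (by linarith) h1
    calc 2 * K * (((K : ℝ) - 1) / c + 1) * α c ≤ 2 * K * K * 1 := by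
          gcongr
          · exact hα0 c hc
          · linarith
      _ = 2 * K ^ 2 := by ring
  have h := hD.trans (Finset.sum_le_sum hterm)
  rw [← ENNReal.ofReal_sum_of_nonneg fun c _ => by positivity, ← Finset.mul_sum] at h
  exact (ENNReal.ofReal_le_ofReal_iff (by positivity)).1 h

/-- No measurability of `N` is needed for this inequality; the bad sets are defined by suprema that
are only a.e. measurable. -/
lemma measure_preimage_pi_le {Ω Z : Type*} [MeasurableSpace Ω] [MeasurableSpace Z] {μ : Measure Ω}
    {Q : Measure Z} {k : ℕ} {S : Fin k → Ω → Z} (hlaw : ∀ i, HasLaw (S i) Q μ)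
    (hindep : iIndepFun S μ) (N : Set (Fin k → Z)) :
    μ ((fun ω i => S i ω) ⁻¹' N) ≤ (Measure.pi fun _ : Fin k => Q) N := by
  have h := hindep.map_fun_eq_pi_map fun i => (hlaw i).aemeasurable
  simp only [(hlaw _).map_eq] at h
  rw [← h]
  exact Measure.le_map_apply (aemeasurable_pi_lambda _ fun i => (hlaw i).aemeasurable) N

end Final

end MCL

/-! ### The estimation error bound -/

theorem mainTheorem3
    {X : Type*} [MeasurableSpace X] {Ω : Type*} [MeasurableSpace Ω]
    (K : ℕ) (hK : 2 ≤ K)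
    -- the joint law of features and labels
    (P : Measure (X × Fin K)) [IsProbabilityMeasure P]
    -- the function class
    (G : Set (X → ℝ)) (hG : ∀ f ∈ G, Measurable f)
    -- the loss: nonnegative, bounded by `C` on the predictions, `L`-Lipschitz (Euclidean norm)
    (ℓ : EuclideanSpace ℝ (Fin K) → Fin K → ℝ) (C : ℝ) (L : ℝ≥0)
    (hℓ0 : ∀ u y, 0 ≤ ℓ u y)
    (hℓC : ∀ g ∈ MCL.productClass K G, ∀ x y, ℓ (g x) y ≤ C)
    (hℓL : ∀ y, LipschitzWith L (fun u => ℓ u y))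
    -- the suprema over the class are random variables
    (hGsup : MCL.HasMeasurableSuprema P.fst G)
    (hdev : ∀ c ∈ Finset.Icc 1 (K - 1),
      MCL.HasMeasurableSuprema (MCL.compMeasure P c) (MCL.deviationClass P ℓ G c))
    -- the convex weights and the sample sizes
    (α : ℕ → ℝ) (hα0 : ∀ c ∈ Finset.Icc 1 (K - 1), 0 ≤ α c)
    (hα1 : ∑ c ∈ Finset.Icc 1 (K - 1), α c = 1)
    (n : ℕ → ℕ) (hn : ∀ c ∈ Finset.Icc 1 (K - 1), 0 < n c)
    -- for each `c`, an i.i.d. sample with `c` complementary labels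
    (μ : Measure Ω) [IsProbabilityMeasure μ]
    (S : (c : ℕ) → Fin (n c) → Ω → X × Finset (Fin K))
    (hSlaw : ∀ c ∈ Finset.Icc 1 (K - 1), ∀ i, HasLaw (S c i) (MCL.compMeasure P c) μ)
    (hSindep : ∀ c ∈ Finset.Icc 1 (K - 1), iIndepFun (S c) μ)
    -- the optimal decision function
    (gstar : X → EuclideanSpace ℝ (Fin K))
    (hgstar : MCL.IsMinimizer (MCL.risk P ℓ) (MCL.productClass K G) gstar)
    (δ : ℝ) (hδ : 0 < δ) :
    ∃ E : Set Ω, MeasurableSet E ∧ ENNReal.ofReal (1 - δ) ≤ μ E ∧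
      ∀ ω ∈ E, ∀ ghat : X → EuclideanSpace ℝ (Fin K),
        MCL.IsMinimizer (MCL.empiricalRisk ℓ α n (fun c i => S c i ω))
          (MCL.productClass K G) ghat →
        -- the estimation error bound
        ENNReal.ofReal (MCL.risk P ℓ ghat - MCL.risk P ℓ gstar) ≤
          ∑ c ∈ Finset.Icc 1 (K - 1),
            ENNReal.ofReal (2 * K * (((K : ℝ) - 1) / c + 1) * α c) *
              (2 * K * L * MCL.rademacher P.fst G (n c) +
                ENNReal.ofReal (C * Real.sqrt (Real.log (2 * K / δ) / (2 * n c)))) ∧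
        -- the parametric rate
        ∀ B : ℝ≥0,
          (∀ m : ℕ, 0 < m → MCL.rademacher P.fst G m ≤ ENNReal.ofReal (B / Real.sqrt m)) →
          MCL.risk P ℓ ghat - MCL.risk P ℓ gstar ≤
            2 * K ^ 2 * (2 * K * L * B + C * Real.sqrt (Real.log (2 * K / δ) / 2)) *
              ∑ c ∈ Finset.Icc 1 (K - 1), 1 / Real.sqrt (n c) := by
  have hX : Nonempty (X × Fin K) := nonempty_of_isProbabilityMeasure P
  have hC0 : 0 ≤ C := (hℓ0 _ hX.some.2).trans (hℓC gstar hgstar.1 hX.some.1 hX.some.2)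
  suffices h : ∃ E : Set Ω, MeasurableSet E ∧ ENNReal.ofReal (1 - δ) ≤ μ E ∧
      ∀ ω ∈ E, ∀ ghat : X → EuclideanSpace ℝ (Fin K),
        MCL.IsMinimizer (MCL.empiricalRisk ℓ α n (fun c i => S c i ω))
          (MCL.productClass K G) ghat →
        ENNReal.ofReal (MCL.risk P ℓ ghat - MCL.risk P ℓ gstar) ≤
          ∑ c ∈ Finset.Icc 1 (K - 1),
            ENNReal.ofReal (2 * K * (((K : ℝ) - 1) / c + 1) * α c) *
              (2 * K * L * MCL.rademacher P.fst G (n c) +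
                ENNReal.ofReal (C * Real.sqrt (Real.log (2 * K / δ) / (2 * n c)))) by
    obtain ⟨E, hE, hμE, h⟩ := h
    exact ⟨E, hE, hμE, fun ω hω ghat hghat => ⟨h ω hω ghat hghat, fun B hB =>
      MCL.parametric_rate hC0 B.2 hα0 hα1 hn (h ω hω ghat hghat) hB⟩⟩
  -- For `δ ≥ 1` the empty event suffices; otherwise the logarithm is nonnegative.
  rcases le_or_gt 1 δ with hδ1 | hδ1
  · exact ⟨∅, .empty, by simp [hδ1], by simp⟩
  -- If `C = 0`, all risks vanish on the class. The tail bound needs `C > 0`, as its exponent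
  -- divides by the oscillation.
  rcases hC0.eq_or_lt with rfl | hCpos
  · have hzero : ∀ g ∈ MCL.productClass K G, MCL.risk P ℓ g = 0 := fun g hg =>
      integral_eq_zero_of_ae (.of_forall fun z => le_antisymm (hℓC g hg _ _) (hℓ0 _ _))
    refine ⟨Set.univ, .univ, ?_, fun ω _ ghat hghat => ?_⟩
    · simpa using hδ.le
    · rw [hzero _ hghat.1, hzero _ hgstar.1]
      simp
  have hne : Nonempty (MCL.productClass K G) := ⟨⟨gstar, hgstar.1⟩⟩
  have hprob : ∀ c ∈ Finset.Icc 1 (K - 1), IsProbabilityMeasure (MCL.compMeasure P c) :=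
    fun c hc => by
      have hl := hSlaw c hc ⟨0, hn c hc⟩
      rw [← hl.map_eq]
      exact Measure.isProbabilityMeasure_map hl.aemeasurable
  let π : (c : ℕ) → Measure (Fin (n c) → X × Finset (Fin K)) :=
    fun c => Measure.pi fun _ => MCL.compMeasure P c
  let D : (τ : ℝ) → (c : ℕ) → (Fin (n c) → X × Finset (Fin K)) → ℝ :=
    fun τ c => MCL.supSum (MCL.deviation P ℓ G c) fun _ => τ / n c
  let t : ℕ → ℝ := fun c =>
    K * (((K : ℝ) - 1) / c + 1) * C * √(Real.log (2 * K / δ) / (2 * n c))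
  let bad : ℝ → ℕ → Set Ω := fun τ c =>
    (fun ω i => S c i ω) ⁻¹' {z | t c ≤ D τ c z - ∫ z, D τ c z ∂(π c)}
  have hbad : ∀ τ : ℝ, |τ| = 1 → ∀ c ∈ Finset.Icc 1 (K - 1),
      μ (bad τ c) ≤ ENNReal.ofReal (δ / (2 * K)) := by
    intro τ hτ c hc
    have := hprob c hc
    exact (MCL.measure_preimage_pi_le (hSlaw c hc) (hSindep c hc) _).trans
      (MCL.measure_supSum_deviation_ge_le hc hG hℓ0 hℓC hCpos hℓL (hdev c hc) hτ (hn c hc) hδ hδ1.le)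
  -- The union bound over `c` and both signs costs `2 (K-1) · δ/(2K) ≤ δ` and needs no independence
  -- between the samples for different `c`.
  let N : Set Ω := ⋃ c ∈ Finset.Icc 1 (K - 1), (bad 1 c ∪ bad (-1) c)
  have hN : μ N ≤ ENNReal.ofReal δ := by
    have hK0 : (0 : ℝ) < K := by exact_mod_cast (by omega : 0 < K)
    calc μ N ≤ ∑ c ∈ Finset.Icc 1 (K - 1), μ (bad 1 c ∪ bad (-1) c) :=
          measure_biUnion_finset_le _ _
      _ ≤ ∑ c ∈ Finset.Icc 1 (K - 1), ENNReal.ofReal (δ / K) := by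
          refine Finset.sum_le_sum fun c hc => (measure_union_le _ _).trans ?_
          refine (add_le_add (hbad 1 (by simp) c hc) (hbad (-1) (by simp) c hc)).trans_eq ?_
          rw [← ENNReal.ofReal_add (by positivity) (by positivity)]
          congr 1
          field_simp
          ring
      _ = ENNReal.ofReal (((K - 1 : ℕ) : ℝ) * (δ / K)) := by
          rw [Finset.sum_const, Nat.card_Icc, ENNReal.ofReal_mul (by positivity)]
          simp
      _ ≤ ENNReal.ofReal δ := by
          refine ENNReal.ofReal_le_ofReal ?_
          rw [mul_div_assoc', div_le_iff₀ hK0, mul_comm δ]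
          gcongr
          exact Nat.sub_le _ _
  -- A measurable hull of `N` has the same measure, so its complement is a genuine event.
  refine ⟨(toMeasurable μ N)ᶜ, (measurableSet_toMeasurable μ N).compl, ?_, ?_⟩
  · rw [prob_compl_eq_one_sub (measurableSet_toMeasurable μ N), measure_toMeasurable,
      ENNReal.ofReal_sub _ hδ.le, ENNReal.ofReal_one]
    gcongr
  intro ω hω ghat hghat
  have hωN : ∀ c ∈ Finset.Icc 1 (K - 1), ω ∉ bad 1 c ∪ bad (-1) c := fun c hc h =>
    hω (subset_toMeasurable μ N (Set.mem_biUnion hc h))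
  have hM : ∀ c ∈ Finset.Icc 1 (K - 1), ∀ g z, |MCL.deviation P ℓ G c g z| ≤
      K * (((K : ℝ) - 1) / c + 1) * C := fun c hc => by
    have := hprob c hc
    exact MCL.abs_deviation_le hc hG hℓ0 hℓC hC0 hℓL
  refine (ENNReal.ofReal_le_ofReal
    (MCL.risk_sub_risk_le hα0 hα1 hn _ hM hgstar.1 hghat)).trans ?_
  refine (MCL.ofReal_sum_le _ _).trans (Finset.sum_le_sum fun c hc => ?_)
  have := hprob c hc
  have hmean := fun τ (hτ : |τ| = 1) => MCL.ofReal_integral_supSum_deviation_le (n := n c) hc hG hℓ0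
    hℓC hC0 hℓL hGsup (hdev c hc) (τ := τ) hτ
  have hω1 : ω ∉ bad 1 c := fun h => hωN c hc (Or.inl h)
  have hω2 : ω ∉ bad (-1) c := fun h => hωN c hc (Or.inr h)
  exact MCL.ofReal_summand_le hc (hα0 c hc) (hmean 1 (by simp)) (hmean (-1) (by simp)) rfl
    (not_le.1 hω1).le (not_le.1 hω2).le
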